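/- Let $K$ be a field and let $M\subseteq\mathbb Z^d$ be a positive normal affine monoid of rank $d$ with $\operatorname{gp}(M)=\mathbb Z^d$; that is, $M$ is finitely generated, generates $\mathbb Z^d$ as a group, contains every $x\in\mathbb Z^d$ with $kx\in M$ for some integer $k\ge1$, and $0$ is its only invertible element. Let $$\mathbb R_+M=\{x\in\mathbb R^d:\sigma_i(x)\ge 0,\ i=1,\dots,s\}$$ be the irredundant representation of the cone generated by $M$ by primitive integral linear forms $\sigma_1,\dots,\sigma_s$, and put $\sigma=(\sigma_1,\dots,\sigma_s):\mathbb R^d\to\mathbb R^s$. Ceilings of vectors are taken componentwise. Let $R=K[M]$. For $n\ge1$ let $R^{1/n}=K[\frac1nM]$ be the monoid algebra of $\frac1nM=\{x/n:x\in M\}$; it contains $R$. For $c\in(\frac1n\mathbb Z^d)/\mathbb Z^d$ let $I_c=R^{1/n}\cap K\cdot c$ be the $R$-submodule of $R^{1/n}$ spanned over $K$ by the monomials with exponent in the residue class $c$. For $y\in\mathbb R^d$ let $\mathcal C(y)=K\cdot(\mathbb Z^d\cap(y+\mathbb R_+M))$ be the corresponding conic divisorial ideal. Let $\gamma$ be an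 open $d$-cell of the cell decomposition of $\mathbb R^d$ by the hyperplanes $\{x:\sigma_i(x)=z\}$, $1\le i\le s$, $z\in\mathbb Z$, and let $\lceil\gamma\rceil=\{x\in\mathbb R^d:\lceil\sigma(x)\rceil=\lceil\sigma(y)\rceil\}$, where $y\in\gamma$ (this set does not depend on $y$). **Theorem.** For all $n\ge1$ one has $R^{1/n}=\bigoplus_c I_c$ as an $R$-module, where $c$ ranges over $(\frac1n\mathbb Z^d)/\mathbb Z^d$. The ideals $\mathcal C(x)$, $x\in\lceil\gamma\rceil$, all coincide; denote their common value by $\mathcal C_\gamma$. For $n\ge 1$ let $v_\gamma(n)$ be the multiplicity of the isomorphism class of $\mathcal C_\gamma$ in this decomposition, i.e. the number of $c\in(\frac1n\mathbb Z^d)/\mathbb Z^d$ such that $I_c\cong\mathcal C_\gamma$ as $R$-modules. Then $$v_\gamma(n)=\#\Bigl(\lceil\gamma\rceil\cap\tfrac1n\mathbb Z^d\Bigr)\qquad\text{for all } n\ge1.$$ Moreover, there exists a quasi-polynomial $q_\gamma:\mathbb Z\to\mathbb Z$ with rational coefficients, of degree at most $d$, such that $v_\gamma(n)=q_\gamma(n)$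 for all $n\ge1$, and $$q_\gamma(n)=\operatorname{vol}(\gamma)\,n^d+a_\gamma n^{d-1}+\tilde q_\gamma(n)\qquad\text{for all } n\in\mathbb Z,$$ where $\operatorname{vol}(\gamma)$, the Lebesgue measure of $\gamma$, is a finite rational number, $a_\gamma\in\mathbb Q$ is constant, and $\tilde q_\gamma$ is a quasi-polynomial with rational coefficients of degree $\le d-2$ (so $\tilde q_\gamma=0$ if $d\le1$). For $d=0$ the term $a_\gamma n^{d-1}$ is read as $0$ at $n=0$. -/

import Mathlib

open scoped Polynomial

noncomputable section

namespace ConicClasses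

variable {d s : ℕ}

/-! ### Affine monoids in the lattice of integral points -/

/-- `M` is a positive normal affine monoid of rank `d`, embedded in `ℤ^d` such that
`gp(M) = ℤ^d`. -/
structure IsPositiveNormalAffine (M : AddSubmonoid (Fin d → ℤ)) : Prop where
  fg : M.FG
  gp_eq_top : AddSubgroup.closure (M : Set (Fin d → ℤ)) = ⊤
  normal : ∀ (x : Fin d → ℤ) (k : ℕ), 0 < k → k • x ∈ M → x ∈ M
  positive : ∀ x ∈ M, -x ∈ M → x = 0

/-- The map `ℤ^d → ℝ^d`, `z ↦ z / n`. -/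
def scaledEmb (d : ℕ) (n : ℕ+) : (Fin d → ℤ) →+ (Fin d → ℝ) where
  toFun z := fun j => (z j : ℝ) / ((n : ℕ) : ℝ)
  map_zero' := by ext j; simp
  map_add' x y := by ext j; simp [add_div]

/-- The lattice `(1/n) ℤ^d` in `ℝ^d`. -/
def scaledLattice (d : ℕ) (n : ℕ+) : AddSubgroup (Fin d → ℝ) :=
  (scaledEmb d n).range

/-- The monoid `(1/n) M` in `ℝ^d`; for `n = 1` this is `M` itself, viewed in `ℝ^d`. -/
def scaledMonoid (M : AddSubmonoid (Fin d → ℤ)) (n : ℕ+) : AddSubmonoid (Fin d → ℝ) :=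
  M.map (scaledEmb d n)

/-- The cone `ℝ₊ M` in `ℝ^d` generated by `M`. -/
def realCone (M : AddSubmonoid (Fin d → ℤ)) : PointedCone ℝ (Fin d → ℝ) :=
  PointedCone.hull ℝ (scaledMonoid M 1 : Set (Fin d → ℝ))

/-- The linear form on `ℝ^d` with integral coefficient vector `a`. -/
def form (a : Fin d → ℤ) (x : Fin d → ℝ) : ℝ := ∑ j, (a j : ℝ) * x j

/-- The forms `σ 0, …, σ (s - 1)` are the support forms of `ℝ₊ M`: they are primitive integral
forms, and the halfspaces `σ i ≥ 0` give an irredundant representation of the cone `ℝ₊ M`. -/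
structure IsSupportForms (M : AddSubmonoid (Fin d → ℤ)) (σ : Fin s → Fin d → ℤ) : Prop where
  primitive : ∀ i, Finset.univ.gcd (σ i) = 1
  cone_eq : (realCone M : Set (Fin d → ℝ)) = {x | ∀ i, 0 ≤ form (σ i) x}
  irredundant : ∀ i, (realCone M : Set (Fin d → ℝ)) ≠ {x | ∀ k, k ≠ i → 0 ≤ form (σ k) x}

/-! ### The cell complex -/

/-- `γ` is an open `d`-cell of the cell decomposition of `ℝ^d` by the hyperplanes
`σ i (x) = z`, `z ∈ ℤ`: a nonempty set which is the preimage under `σ` of an open lattice cube of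
side length `1` in `ℝ^s`. -/
def IsOpenCell (σ : Fin s → Fin d → ℤ) (γ : Set (Fin d → ℝ)) : Prop :=
  γ.Nonempty ∧ ∃ u : Fin s → ℤ, γ = {x | ∀ i, (u i : ℝ) - 1 < form (σ i) x ∧ form (σ i) x < u i}

/-- The upper closure `⌈γ⌉` of a cell: all `x` with `⌈σ(x)⌉ = ⌈σ(y)⌉` for `y ∈ γ`. -/
def cellCeil (σ : Fin s → Fin d → ℤ) (γ : Set (Fin d → ℝ)) : Set (Fin d → ℝ) :=
  {x | ∃ y ∈ γ, ∀ i, ⌈form (σ i) x⌉ = ⌈form (σ i) y⌉}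

/-! ### Monoid algebras and monomial modules inside the group algebra of `ℝ^d` -/

variable (K : Type*) [Field K]

/-- The monoid algebra `K[N]` of a submonoid `N` of `ℝ^d`, as the subalgebra of the group algebra
`K[ℝ^d]` of all elements supported in `N`. -/
def monoidAlg (N : AddSubmonoid (Fin d → ℝ)) :
    Subalgebra K (AddMonoidAlgebra K (Fin d → ℝ)) where
  carrier := {f | ∀ x ∈ f.coeff.support, x ∈ N}
  add_mem' {f g} hf hg x hx := by
    classical
    exact (Finset.mem_union.1 (Finsupp.support_add hx)).elim (hf x) (hg x)
  mul_mem' {f g} hf hg x hx := by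
    classical
    obtain ⟨a, ha, b, hb, rfl⟩ :=
      Finset.mem_add.1 (AddMonoidAlgebra.support_coeff_mul_subset f g hx)
    exact N.add_mem (hf a ha) (hg b hb)
  algebraMap_mem' r x hx := by
    have h := Finsupp.support_single_subset hx
    rw [Finset.mem_singleton] at h
    rw [h]
    exact N.zero_mem

/-- The `K`-subspace `K · S` of `K[ℝ^d]` with monomial basis `S`, as a `K[N]`-module, where
`S ⊆ ℝ^d` satisfies `N + S ⊆ S`. -/
def monomialModule (N : AddSubmonoid (Fin d → ℝ)) (S : Set (Fin d → ℝ))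
    (hS : ∀ m ∈ N, ∀ x ∈ S, m + x ∈ S) :
    Submodule (monoidAlg K N) (AddMonoidAlgebra K (Fin d → ℝ)) where
  carrier := {f | ∀ x ∈ f.coeff.support, x ∈ S}
  add_mem' {f g} hf hg x hx := by
    classical
    exact (Finset.mem_union.1 (Finsupp.support_add hx)).elim (hf x) (hg x)
  zero_mem' x hx := by simp at hx
  smul_mem' r f hf x hx := by
    classical
    rw [Subalgebra.smul_def, smul_eq_mul] at hx
    obtain ⟨a, ha, b, hb, rfl⟩ :=
      Finset.mem_add.1 (AddMonoidAlgebra.support_coeff_mul_subset r.1 f hx)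
    exact hS a (r.2 a ha) b (hf b hb)

/-- The ring `R = K[M]`. -/
abbrev ring (M : AddSubmonoid (Fin d → ℤ)) : Subalgebra K (AddMonoidAlgebra K (Fin d → ℝ)) :=
  monoidAlg K (scaledMonoid M 1)

/-- The extension ring `R^{1/n} = K[(1/n) M]` of `R`. -/
abbrev rootRing (M : AddSubmonoid (Fin d → ℤ)) (n : ℕ+) :
    Subalgebra K (AddMonoidAlgebra K (Fin d → ℝ)) :=
  monoidAlg K (scaledMonoid M n)

/-- The conic divisorial ideal `𝒞(y) = K · (ℤ^d ∩ (y + ℝ₊ M))`, as a module over `R = K[M]`. -/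
def conic (M : AddSubmonoid (Fin d → ℤ)) (y : Fin d → ℝ) :
    Submodule (ring K M) (AddMonoidAlgebra K (Fin d → ℝ)) :=
  monomialModule K (scaledMonoid M 1) {x | x ∈ scaledLattice d 1 ∧ x - y ∈ realCone M} (by
    rintro m hm x ⟨hx, hxy⟩
    refine ⟨(scaledLattice d 1).add_mem ?_ hx, ?_⟩
    · obtain ⟨z, -, rfl⟩ := hm
      exact ⟨z, rfl⟩
    · rw [add_sub_assoc]
      exact (realCone M).add_mem (PointedCone.subset_hull hm) hxy)

/-- The group of residue classes `(1/n) ℤ^d / ℤ^d`. -/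
abbrev ResidueClass (d : ℕ) (n : ℕ+) : Type :=
  scaledLattice d n ⧸ (scaledLattice d 1).addSubgroupOf (scaledLattice d n)

/-- The `R`-module `I_c = R^{1/n} ∩ K · c`, for a residue class `c ∈ (1/n) ℤ^d / ℤ^d`. -/
def summand (M : AddSubmonoid (Fin d → ℤ)) (n : ℕ+) (c : ResidueClass d n) :
    Submodule (ring K M) (AddMonoidAlgebra K (Fin d → ℝ)) :=
  monomialModule K (scaledMonoid M 1)
    {x | x ∈ scaledMonoid M n ∧
      ∃ h : x ∈ scaledLattice d n, (QuotientAddGroup.mk ⟨x, h⟩ : ResidueClass d n) = c} (by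
    rintro m ⟨z, hz, rfl⟩ x ⟨hx, h, rfl⟩
    have key : scaledEmb d 1 z = scaledEmb d n ((n : ℕ) • z) := by
      ext j
      simp [scaledEmb]
    have hmem : scaledEmb d 1 z ∈ scaledLattice d n := key ▸ ⟨_, rfl⟩
    refine ⟨?_, (scaledLattice d n).add_mem hmem h, ?_⟩
    · refine (scaledMonoid M n).add_mem ?_ hx
      rw [key]
      exact ⟨_, M.nsmul_mem hz _, rfl⟩
    · refine QuotientAddGroup.eq.2 ?_
      refine AddSubgroup.mem_addSubgroupOf.2 ⟨-z, ?_⟩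
      simp)

/-- The multiplicity of the isomorphism class of the `R`-module `C` in the decomposition
`R^{1/n} = ⨁ I_c`: the number of `c ∈ (1/n) ℤ^d / ℤ^d` with `I_c ≅ C`. -/
def multiplicity (M : AddSubmonoid (Fin d → ℤ)) (n : ℕ+)
    (C : Submodule (ring K M) (AddMonoidAlgebra K (Fin d → ℝ))) : ℕ :=
  Nat.card {c : ResidueClass d n // Nonempty (summand K M n c ≃ₗ[ring K M] C)}

end ConicClasses

end

/-- `f : ℤ → ℚ` is a quasi-polynomial with rational coefficients and of degree at most `e`:
for some `p ≥ 1`, it is given on each residue class modulo `p` by a polynomial over `ℚ` without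
terms of degree `> e`. For `e < 0` this forces `f = 0`. -/
def ConicClasses.IsQuasiPolynomial (f : ℤ → ℚ) (e : ℤ) : Prop :=
  ∃ p : ℕ, 0 < p ∧ ∃ P : ZMod p → ℚ[X],
    (∀ r, ∀ k : ℕ, e < k → (P r).coeff k = 0) ∧ ∀ n : ℤ, f n = (P n).eval (n : ℚ)

/-! Algebra. An integral point `z` lies in `y + ℝ₊M` iff `σ i (z) ≥ ⌈σ i (y)⌉` for all `i`, so
`𝒞(y)` depends only on `⌈σ(y)⌉`. Conversely each ceiling is recovered from `𝒞(y)` as the minimum of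
`σ i` on its exponents (`ceil_le_of_conicSet_subset`). By normality, `I_{-y}` is the translate of
`𝒞(y)` by `-y`. Units of the group algebra of `ℝ^d` are monomials, so an isomorphism between such
modules is a translation of exponents (`nonempty_linearEquiv_iff`). Hence `I_{-y} ≅ 𝒞_γ` iff `y +
ℤ^d` meets `⌈γ⌉`, and it does so at most once because `σ` separates points; this is
`multiplicity_eq`.

Quasi-polynomiality. After scaling by `n`, the points of `⌈γ⌉ ∩ (1/n)ℤ^d` are the integral solutions
of `n(u - 1) < σ ≤ nu`. They are counted by summing an indicator function over one coordinate at a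
time, inside an algebra of piecewise quasi-polynomials that is closed under summation between linear
bounds (`sum_Ioc_mem_pqAlg`). On the ray `n > 0` only one piece is left. The leading coefficient is
the volume, by a Riemann sum.

The second coefficient. Let `N(b)` count the lattice points with `τ ≤ b`, where `τ = (σ, -σ)`. The
mixed second difference of `N` in two distinct bounds counts points on a face of codimension two,
hence is `O(n^(d-2))`; for opposite bounds it is eventually zero. Moreover `N` is invariant under `b
↦ b + τ(w)`, and primitivity provides `w` with `τ k (w) = 1`; so pure second differences reduce to
mixed ones (`isBigO_second_difference`). Thus the counting function has second differences
`O(n^(d-2))`. Comparing coefficients of `n^(d-1)`, with the constant leading coefficient cancelling,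
shows that the second coefficient has vanishing second differences along `ℤ/p`; a periodic
arithmetic progression is constant. -/

noncomputable section

namespace ConicClasses

/-! ### Quasi-polynomial functions on abelian groups and their antidifferences -/

section QuasiPolynomialFunctions

variable {G H : Type*} [AddCommGroup G] [AddCommGroup H]

/-- A function on an abelian group that factors through `G ⧸ p G` for some `p ≥ 1`. -/
def IsPeriodicFun (f : G → ℚ) : Prop := ∃ p : ℕ, 0 < p ∧ ∀ x y, f (x + p • y) = f x

variable (G) in
/-- Quasi-polynomial functions on an abelian group. -/
def qpAlg : Subalgebra ℚ (G → ℚ) :=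
  Algebra.adjoin ℚ ({f | ∃ φ : G →+ ℤ, f = fun x => (φ x : ℚ)} ∪ {f | IsPeriodicFun f})

variable (G) in
/-- Functions that are quasi-polynomial on the cones of a fan of rational cones. -/
def pqAlg : Subalgebra ℚ (G → ℚ) :=
  Algebra.adjoin ℚ (({f | ∃ φ : G →+ ℤ, f = fun x => (φ x : ℚ)} ∪ {f | IsPeriodicFun f}) ∪
    {f | ∃ φ : G →+ ℤ, f = fun x => if 0 ≤ φ x then 1 else 0})

theorem qpAlg_le_pqAlg : qpAlg G ≤ pqAlg G :=
  Algebra.adjoin_mono Set.subset_union_left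

theorem hom_mem_qpAlg (φ : G →+ ℤ) : (fun x => (φ x : ℚ)) ∈ qpAlg G :=
  Algebra.subset_adjoin (Or.inl ⟨φ, rfl⟩)

theorem periodic_mem_qpAlg {f : G → ℚ} (h : IsPeriodicFun f) : f ∈ qpAlg G :=
  Algebra.subset_adjoin (Or.inr h)

theorem indicator_mem_pqAlg (φ : G →+ ℤ) :
    (fun x => if 0 ≤ φ x then (1 : ℚ) else 0) ∈ pqAlg G :=
  Algebra.subset_adjoin (Or.inr ⟨φ, rfl⟩)

theorem strict_indicator_mem_pqAlg (φ : G →+ ℤ) :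
    (fun x => if 0 < φ x then (1 : ℚ) else 0) ∈ pqAlg G := by
  have h := (pqAlg G).sub_mem (pqAlg G).one_mem (indicator_mem_pqAlg (-φ))
  convert h using 1
  ext x
  have e : (-φ) x = -φ x := rfl
  simp only [Pi.sub_apply, Pi.one_apply]
  by_cases h' : 0 < φ x
  · rw [if_pos h', if_neg (by rw [e]; omega), sub_zero]
  · rw [if_neg h', if_pos (by rw [e]; omega), sub_self]

theorem const_mem_qpAlg (c : ℚ) : (fun _ : G => c) ∈ qpAlg G :=
  (qpAlg G).algebraMap_mem c

/-- Substitution respects sums and products, so it is enough to test it on generators. The map `u`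
need not be a homomorphism, which allows shifts and floor functions. -/
theorem comp_mem_qpAlg (u : H → G)
    (h₁ : ∀ φ : G →+ ℤ, (fun x => (φ (u x) : ℚ)) ∈ qpAlg H)
    (h₂ : ∀ f : G → ℚ, IsPeriodicFun f → (fun x => f (u x)) ∈ qpAlg H)
    {f : G → ℚ} (hf : f ∈ qpAlg G) : (fun x => f (u x)) ∈ qpAlg H := by
  induction hf using Algebra.adjoin_induction with
  | mem f hf =>
    rcases hf with ⟨φ, rfl⟩ | hf
    · exact h₁ φ
    · exact h₂ f hf
  | algebraMap r => exact (qpAlg H).algebraMap_mem r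
  | add f g _ _ hf hg => exact (qpAlg H).add_mem hf hg
  | mul f g _ _ hf hg => exact (qpAlg H).mul_mem hf hg

theorem IsPeriodicFun.comp_hom {f : G → ℚ} (hf : IsPeriodicFun f) (u : H →+ G) :
    IsPeriodicFun fun x => f (u x) := by
  obtain ⟨p, hp, h⟩ := hf
  exact ⟨p, hp, fun x y => by simp [h]⟩

theorem comp_hom_mem_qpAlg (u : H →+ G) {f : G → ℚ} (hf : f ∈ qpAlg G) :
    (fun x => f (u x)) ∈ qpAlg H :=
  comp_mem_qpAlg u (fun φ => hom_mem_qpAlg (φ.comp u))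
    (fun _ hf => periodic_mem_qpAlg (hf.comp_hom u)) hf

theorem comp_shift_mem_qpAlg (a : G) {f : G → ℚ} (hf : f ∈ qpAlg G) :
    (fun x => f (x + a)) ∈ qpAlg G := by
  refine comp_mem_qpAlg (fun x => x + a) (fun φ => ?_) (fun f hf => ?_) hf
  · convert (qpAlg G).add_mem (hom_mem_qpAlg φ) (const_mem_qpAlg (φ a : ℚ)) using 1
    ext x
    simp
  · obtain ⟨p, hp, h⟩ := hf
    exact periodic_mem_qpAlg ⟨p, hp, fun x y => by
      beta_reduce
      rw [show x + p • y + a = (x + a) + p • y by abel, h]⟩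

theorem comp_hom_mem_pqAlg (u : H →+ G) {f : G → ℚ} (hf : f ∈ pqAlg G) :
    (fun x => f (u x)) ∈ pqAlg H := by
  induction hf using Algebra.adjoin_induction with
  | mem f hf =>
    rcases hf with (⟨φ, rfl⟩ | hf) | ⟨φ, rfl⟩
    · exact qpAlg_le_pqAlg (hom_mem_qpAlg (φ.comp u))
    · exact qpAlg_le_pqAlg (periodic_mem_qpAlg (hf.comp_hom u))
    · exact indicator_mem_pqAlg (φ.comp u)
  | algebraMap r => exact (pqAlg H).algebraMap_mem r
  | add f g _ _ hf hg => exact (pqAlg H).add_mem hf hg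
  | mul f g _ _ hf hg => exact (pqAlg H).mul_mem hf hg

/-- The floor is `(φ - remainder) / c`, and the remainder is periodic. -/
theorem ediv_mem_qpAlg (φ : G →+ ℤ) (c : ℕ) (hc : 0 < c) :
    (fun x => ((φ x / (c : ℤ) : ℤ) : ℚ)) ∈ qpAlg G := by
  have h₁ : (fun x => ((φ x % (c : ℤ) : ℤ) : ℚ)) ∈ qpAlg G :=
    periodic_mem_qpAlg ⟨c, hc, fun x y => by simp⟩
  have h₂ := (qpAlg G).smul_mem ((qpAlg G).sub_mem (hom_mem_qpAlg φ) h₁) (c : ℚ)⁻¹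
  convert h₂ using 1
  ext x
  have hc' : (c : ℚ) ≠ 0 := by positivity
  have := Int.emod_add_mul_ediv (φ x) c
  simp only [Pi.smul_apply, Pi.sub_apply, smul_eq_mul]
  rw [eq_inv_mul_iff_mul_eq₀ hc', eq_sub_iff_add_eq']
  exact_mod_cast this

/-- Substituting `t = ⌊φ x / c⌋ + e` into a quasi-polynomial function of `(x, t)`. -/
theorem comp_ediv_mem_qpAlg (φ : G →+ ℤ) (c : ℕ) (hc : 0 < c) (e : ℤ) {f : G × ℤ → ℚ}
    (hf : f ∈ qpAlg (G × ℤ)) : (fun x => f (x, φ x / (c : ℤ) + e)) ∈ qpAlg G := by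
  refine comp_mem_qpAlg (fun x => (x, φ x / (c : ℤ) + e)) (fun ψ => ?_) (fun f hf => ?_) hf
  · have h := (qpAlg G).add_mem (hom_mem_qpAlg (ψ.comp (AddMonoidHom.inl G ℤ)))
      ((qpAlg G).smul_mem ((qpAlg G).add_mem (ediv_mem_qpAlg φ c hc) (const_mem_qpAlg (e : ℚ)))
        (ψ (0, 1) : ℚ))
    convert h using 1
    ext x
    have : (x, φ x / (c : ℤ) + e) = (x, 0) + (φ x / (c : ℤ) + e) • ((0, 1) : G × ℤ) := by
      ext <;> simp
    rw [this, map_add, map_zsmul]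
    simp [mul_comm]
    ring
  · obtain ⟨p, hp, h⟩ := hf
    -- Moving `x` by `p c y` changes the floor by exactly `p φ(y)`, so the pair `(x, t)` moves by a
    -- multiple of `p`.
    refine periodic_mem_qpAlg ⟨p * c, by positivity, fun x y => ?_⟩
    have hc' : (c : ℤ) ≠ 0 := by positivity
    have : (φ (x + (p * c) • y)) / (c : ℤ) = φ x / c + p * φ y := by
      rw [map_add, map_nsmul, nsmul_eq_mul]
      push_cast
      rw [show φ x + (p : ℤ) * c * φ y = φ x + (p * φ y) * c by ring,
        Int.add_mul_ediv_right _ _ hc']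
    beta_reduce
    rw [this, ← h (x, φ x / (c : ℤ) + e) (c • y, φ y)]
    congr 1
    ext
    · simp [mul_smul]
    · simp; ring

/-- A span closed under products of its generators and containing `1` is a subalgebra; this is how
normal forms for elements of the function algebras are obtained. -/
theorem adjoin_subset_span {A : Type*} [CommRing A] [Algebra ℚ A] {S T : Set A}
    (hS : S ⊆ Submodule.span ℚ T) (h1 : (1 : A) ∈ Submodule.span ℚ T)
    (hmul : ∀ a ∈ T, ∀ b ∈ T, a * b ∈ Submodule.span ℚ T) {f : A}
    (hf : f ∈ Algebra.adjoin ℚ S) : f ∈ Submodule.span ℚ T := by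
  induction hf using Algebra.adjoin_induction with
  | mem f hf => exact hS hf
  | algebraMap r =>
    rw [Algebra.algebraMap_eq_smul_one]
    exact Submodule.smul_mem _ _ h1
  | add f g _ _ hf hg => exact Submodule.add_mem _ hf hg
  | mul f g _ _ hf hg =>
    have h : Submodule.span ℚ T * Submodule.span ℚ T ≤ Submodule.span ℚ T := by
      rw [Submodule.span_mul_span]
      refine Submodule.span_le.2 ?_
      rintro _ ⟨a, ha, b, hb, rfl⟩
      exact hmul a ha b hb
    exact h (Submodule.mul_mem_mul hf hg)

/-- The Bernoulli identity `B_{e+1}(1 + y) - B_{e+1}(y) = (e + 1) y^e`, rescaled by `y = t / p`. -/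
theorem exists_polynomial_sub_eq_pow (p e : ℕ) (hp : 0 < p) :
    ∃ P : ℚ[X], ∀ t : ℚ, P.eval t - P.eval (t - p) = t ^ e := by
  have hp' : (p : ℚ) ≠ 0 := by positivity
  have he : (e : ℚ) + 1 ≠ 0 := by positivity
  refine ⟨Polynomial.C ((p : ℚ) ^ e / (e + 1)) * (Polynomial.bernoulli (e + 1)).comp
    (Polynomial.C (1 / (p : ℚ)) * Polynomial.X + 1), fun t => ?_⟩
  have h := Polynomial.bernoulli_eval_one_add (e + 1) (t / p)
  simp only [Polynomial.eval_mul, Polynomial.eval_C, Polynomial.eval_comp, Polynomial.eval_add,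
    Polynomial.eval_X, Polynomial.eval_one]
  rw [show 1 / (p : ℚ) * t + 1 = 1 + t / p by ring,
    show 1 / (p : ℚ) * (t - p) + 1 = t / p by field_simp; ring, h]
  simp only [Nat.add_sub_cancel]
  push_cast
  rw [div_pow]
  field_simp
  ring

/-- Quasi-polynomial functions have quasi-polynomial antidifferences. -/
theorem exists_antidifference_qpAlg {f : G × ℤ → ℚ} (hf : f ∈ qpAlg (G × ℤ)) :
    ∃ F ∈ qpAlg (G × ℤ), ∀ x t, F (x, t) - F (x, t - 1) = f (x, t) := by
  -- `B` serves as the ring of coefficients: its elements are periodic in `t`, and every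
  -- quasi-polynomial function is a sum of terms `b * t ^ e` with `b ∈ B`.
  set B : Subalgebra ℚ (G × ℤ → ℚ) := Algebra.adjoin ℚ
    ({f | ∃ φ : G →+ ℤ, f = fun x => (φ x.1 : ℚ)} ∪ {f | IsPeriodicFun f}) with hB
  have hBqp : B ≤ qpAlg (G × ℤ) := by
    refine Algebra.adjoin_le ?_
    rintro f (⟨φ, rfl⟩ | hf)
    · exact hom_mem_qpAlg (φ.comp (AddMonoidHom.fst G ℤ))
    · exact periodic_mem_qpAlg hf
  have hBper : ∀ b ∈ B, ∃ p : ℕ, 0 < p ∧ ∀ x t, ∀ k : ℤ, b (x, t + p * k) = b (x, t) := by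
    intro b hb
    induction hb using Algebra.adjoin_induction with
    | mem f hf =>
      rcases hf with ⟨φ, rfl⟩ | ⟨p, hp, h⟩
      · exact ⟨1, one_pos, fun x t k => rfl⟩
      · refine ⟨p, hp, fun x t k => ?_⟩
        rw [← h (x, t) (0, k)]
        simp
    | algebraMap r => exact ⟨1, one_pos, fun x t k => rfl⟩
    | add f g _ _ hf hg =>
      obtain ⟨p, hp, h⟩ := hf
      obtain ⟨q, hq, h'⟩ := hg
      refine ⟨p * q, by positivity, fun x t k => ?_⟩
      have e1 := h x t (q * k)
      have e2 := h' x t (p * k)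
      simp only [Pi.add_apply]
      rw [← e1, ← e2]
      push_cast
      congr 2 <;> (congr 2; ring)
    | mul f g _ _ hf hg =>
      obtain ⟨p, hp, h⟩ := hf
      obtain ⟨q, hq, h'⟩ := hg
      refine ⟨p * q, by positivity, fun x t k => ?_⟩
      have e1 := h x t (q * k)
      have e2 := h' x t (p * k)
      simp only [Pi.mul_apply]
      rw [← e1, ← e2]
      push_cast
      congr 2 <;> (congr 2; ring)
  have ht : (fun x : G × ℤ => (x.2 : ℚ)) ∈ qpAlg (G × ℤ) := hom_mem_qpAlg (AddMonoidHom.snd G ℤ)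
  have hspan : f ∈ Submodule.span ℚ
      {f : G × ℤ → ℚ | ∃ b ∈ B, ∃ e : ℕ, f = fun x => b x * (x.2 : ℚ) ^ e} := by
    refine adjoin_subset_span ?_ (Submodule.subset_span ?_) ?_ hf
    · rintro f (⟨φ, rfl⟩ | hf)
      · have : (fun x : G × ℤ => (φ x : ℚ)) = (fun x : G × ℤ => (φ (x.1, 0) : ℚ) * (x.2 : ℚ) ^ 0) +
            (φ (0, 1) : ℚ) • (fun x => (1 : G × ℤ → ℚ) x * (x.2 : ℚ) ^ 1) := by
          ext x
          have : x = (x.1, 0) + x.2 • ((0, 1) : G × ℤ) := by ext <;> simp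
          conv_lhs => rw [this, map_add, map_zsmul]
          simp [mul_comm]
        rw [this]
        refine Submodule.add_mem _ (Submodule.subset_span ⟨_, ?_, 0, rfl⟩)
          (Submodule.smul_mem _ _ (Submodule.subset_span ⟨1, B.one_mem, 1, rfl⟩))
        exact Algebra.subset_adjoin (Or.inl ⟨φ.comp (AddMonoidHom.inl G ℤ), rfl⟩)
      · exact Submodule.subset_span ⟨f, Algebra.subset_adjoin (Or.inr hf), 0, by ext; simp⟩
    · exact ⟨1, B.one_mem, 0, by ext; simp⟩
    · rintro _ ⟨b, hb, e, rfl⟩ _ ⟨b', hb', e', rfl⟩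
      refine Submodule.subset_span ⟨b * b', B.mul_mem hb hb', e + e', ?_⟩
      ext x
      simp only [Pi.mul_apply]
      ring
  clear hf
  induction hspan using Submodule.span_induction with
  | mem f hf' =>
    obtain ⟨b, hb, e, rfl⟩ := hf'
    obtain ⟨p, hp, hper⟩ := hBper b hb
    obtain ⟨P, hP⟩ := exists_polynomial_sub_eq_pow p e hp
    have hPmem : (fun x : G × ℤ => P.eval (x.2 : ℚ)) ∈ qpAlg (G × ℤ) := by
      have : (fun x : G × ℤ => P.eval (x.2 : ℚ)) =
          Polynomial.aeval (fun x : G × ℤ => (x.2 : ℚ)) P := by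
        ext x
        rw [Polynomial.aeval_fn_apply, Polynomial.coe_aeval_eq_eval]
      rw [this]
      exact Algebra.adjoin_le (Set.singleton_subset_iff.2 ht)
        (Polynomial.aeval_mem_adjoin_singleton ℚ _)
    set Hf : G × ℤ → ℚ := fun x => b x * P.eval (x.2 : ℚ) with hHf
    have hH : Hf ∈ qpAlg (G × ℤ) := (qpAlg _).mul_mem (hBqp hb) hPmem
    -- Since `b` has period `p` in `t`, the function `Hf` has the right difference for step `p`.
    -- Summing over `p` consecutive shifts telescopes a difference of step `1` into one of step `p`.
    refine ⟨∑ j ∈ Finset.range p, fun x => Hf (x + (0, -(j : ℤ))),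
      (qpAlg _).sum_mem fun j _ => comp_shift_mem_qpAlg _ hH, fun x t => ?_⟩
    simp only [Finset.sum_apply, Prod.mk_add_mk, add_zero]
    rw [← Finset.sum_sub_distrib]
    have key := Finset.sum_range_sub' (fun j : ℕ => Hf (x, t - j)) p
    have e1 : Hf (x, t - p) = b (x, t) * P.eval ((t : ℚ) - p) := by
      have := hper x t (-1)
      simp only [hHf]
      rw [show t - (p : ℤ) = t + p * (-1) by ring, this]
      push_cast
      ring_nf
    calc _ = ∑ j ∈ Finset.range p, (Hf (x, t - j) - Hf (x, t - (j + 1 : ℕ))) := by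
          refine Finset.sum_congr rfl fun j _ => ?_
          push_cast
          congr 3
          ring
      _ = Hf (x, t - (0 : ℕ)) - Hf (x, t - p) := key
      _ = b (x, t) * (t : ℚ) ^ e := by
          rw [e1, ← hP]
          simp [hHf]
          ring
  | zero => exact ⟨0, (qpAlg _).zero_mem, by simp⟩
  | add f g _ _ hf hg =>
    obtain ⟨F, hF, h⟩ := hf
    obtain ⟨F', hF', h'⟩ := hg
    refine ⟨F + F', (qpAlg _).add_mem hF hF', fun x t => ?_⟩
    simp only [Pi.add_apply, ← h, ← h']
    ring
  | smul c f _ hf =>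
    obtain ⟨F, hF, h⟩ := hf
    refine ⟨c • F, (qpAlg _).smul_mem hF c, fun x t => ?_⟩
    simp only [Pi.smul_apply, ← h, smul_eq_mul]
    ring

end QuasiPolynomialFunctions

/-! ### Piecewise quasi-polynomials and summation over lattice points -/

section PiecewiseSummation

variable {G : Type*} [AddCommGroup G]

/-- The linear function `(x, t) ↦ a x + c t`. -/
def linHom (a : G →+ ℤ) (c : ℤ) : G × ℤ →+ ℤ :=
  AddMonoidHom.coprod a (AddMonoidHom.mulLeft c)

@[simp] theorem linHom_apply (a : G →+ ℤ) (c : ℤ) (x : G × ℤ) :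
    linHom a c x = a x.1 + c * x.2 := rfl

theorem exists_eq_linHom (φ : G × ℤ →+ ℤ) : ∃ a c, φ = linHom a c := by
  refine ⟨φ.comp (AddMonoidHom.inl G ℤ), φ (0, 1), ?_⟩
  ext x
  conv_lhs => rw [show x = (x.1, 0) + x.2 • ((0, 1) : G × ℤ) by ext <;> simp, map_add, map_zsmul]
  simp [mul_comm]

/-- The constant function `1` and the indicator functions of the half-spaces `a x + c t ≥ 0` and
`a x + c t > 0` with `c > 0`. -/
inductive IsStep : (G × ℤ → ℚ) → Prop
  | one : IsStep 1
  | weak (a : G →+ ℤ) (c : ℕ) (hc : 0 < c) :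
      IsStep fun x => if 0 ≤ a x.1 + c * x.2 then 1 else 0
  | strict (a : G →+ ℤ) (c : ℕ) (hc : 0 < c) :
      IsStep fun x => if 0 < a x.1 + c * x.2 then 1 else 0

theorem IsStep.mem_pqAlg {u : G × ℤ → ℚ} (hu : IsStep u) : u ∈ pqAlg (G × ℤ) := by
  cases hu with
  | one => exact (pqAlg _).one_mem
  | weak a c hc => exact indicator_mem_pqAlg (linHom a c)
  | strict a c hc => exact strict_indicator_mem_pqAlg (linHom a c)

theorem one_sub_ite (P : Prop) [Decidable P] :
    (1 : ℚ) - (if P then 1 else 0) = if P then 0 else 1 := by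
  split_ifs <;> simp

/-- The condition `k` tells which of `P` and `Q` is the stronger one, and the product equals the
indicator of the stronger. -/
theorem ite_mul_ite {P Q k : Prop} [Decidable P] [Decidable Q] [Decidable k] (h₁ : k → P → Q)
    (h₂ : ¬k → Q → P) : ((if P then 1 else 0) * (if Q then 1 else 0) : ℚ) =
      (if k then 1 else 0) * (if P then 1 else 0) +
        (1 - if k then 1 else 0) * (if Q then 1 else 0) := by
  by_cases hk : k <;> by_cases hP : P <;> by_cases hQ : Q <;> simp_all

/-- The product of two step functions selects the one with the larger threshold. -/
theorem IsStep.mul {u v : G × ℤ → ℚ} (hu : IsStep u) (hv : IsStep v) :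
    ∃ κ ∈ pqAlg G, ∀ x, u x * v x = κ x.1 * u x + (1 - κ x.1) * v x := by
  -- The thresholds are `-a/c` and `-a'/c'`, so the sign of `c a' - c' a` decides which is larger.
  -- At a tie the strict inequality must win: the selector is therefore `≥ 0` when `u` is strict and
  -- `> 0` when `u` is weak.
  have hsub : ∀ (a a' : G →+ ℤ) (c c' : ℕ) (x : G),
    ((c : ℤ) • a' - (c' : ℤ) • a) x = c * a' x - c' * a x := fun _ _ _ _ _ => rfl
  cases hu with
  | one => exact ⟨0, (pqAlg G).zero_mem, by simp⟩
  | weak a c hc =>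
    have h1 : (0 : ℤ) < c := by exact_mod_cast hc
    cases hv with
    | one => exact ⟨1, (pqAlg G).one_mem, by simp⟩
    | weak a' c' hc' =>
      have h2 : (0 : ℤ) < c' := by exact_mod_cast hc'
      refine ⟨_, strict_indicator_mem_pqAlg ((c : ℤ) • a' - (c' : ℤ) • a), fun x =>
        ite_mul_ite (fun hk hp => ?_) (fun hk hp => ?_)⟩ <;> rw [hsub] at hk <;> nlinarith
    | strict a' c' hc' =>
      have h2 : (0 : ℤ) < c' := by exact_mod_cast hc'
      refine ⟨_, strict_indicator_mem_pqAlg ((c : ℤ) • a' - (c' : ℤ) • a), fun x =>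
        ite_mul_ite (fun hk hp => ?_) (fun hk hp => ?_)⟩ <;> rw [hsub] at hk <;> nlinarith
  | strict a c hc =>
    have h1 : (0 : ℤ) < c := by exact_mod_cast hc
    cases hv with
    | one => exact ⟨1, (pqAlg G).one_mem, by simp⟩
    | weak a' c' hc' =>
      have h2 : (0 : ℤ) < c' := by exact_mod_cast hc'
      refine ⟨_, indicator_mem_pqAlg ((c : ℤ) • a' - (c' : ℤ) • a), fun x =>
        ite_mul_ite (fun hk hp => ?_) (fun hk hp => ?_)⟩ <;> rw [hsub] at hk <;> nlinarith
    | strict a' c' hc' =>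
      have h2 : (0 : ℤ) < c' := by exact_mod_cast hc'
      refine ⟨_, indicator_mem_pqAlg ((c : ℤ) • a' - (c' : ℤ) • a), fun x =>
        ite_mul_ite (fun hk hp => ?_) (fun hk hp => ?_)⟩ <;> rw [hsub] at hk <;> nlinarith

theorem fst_mem_pqAlg {f : G → ℚ} (hf : f ∈ pqAlg G) :
    (fun x : G × ℤ => f x.1) ∈ pqAlg (G × ℤ) :=
  comp_hom_mem_pqAlg (AddMonoidHom.fst G ℤ) hf

/-- Every piecewise quasi-polynomial function of `(x, t)` is a combination of quasi-polynomial
functions of `(x, t)`, cut off below in `t`, with coefficients depending only on `x`. -/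
theorem pqAlg_subset_span {f : G × ℤ → ℚ} (hf : f ∈ pqAlg (G × ℤ)) :
    f ∈ Submodule.span ℚ {f : G × ℤ → ℚ | ∃ a ∈ pqAlg G, ∃ w ∈ qpAlg (G × ℤ), ∃ u, IsStep u ∧
      f = fun x => a x.1 * (w x * u x)} := by
  have hqp : ∀ w ∈ qpAlg (G × ℤ), w ∈ Submodule.span ℚ {f : G × ℤ → ℚ | ∃ a ∈ pqAlg G,
      ∃ w ∈ qpAlg (G × ℤ), ∃ u, IsStep u ∧ f = fun x => a x.1 * (w x * u x)} := fun w hw =>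
    Submodule.subset_span ⟨1, (pqAlg G).one_mem, w, hw, 1, .one, by ext; simp⟩
  have hstep : ∀ u : G × ℤ → ℚ, IsStep u → u ∈ Submodule.span ℚ {f : G × ℤ → ℚ | ∃ a ∈ pqAlg G,
      ∃ w ∈ qpAlg (G × ℤ), ∃ u, IsStep u ∧ f = fun x => a x.1 * (w x * u x)} := fun u hu =>
    Submodule.subset_span ⟨1, (pqAlg G).one_mem, 1, (qpAlg _).one_mem, u, hu, by ext; simp⟩
  refine adjoin_subset_span ?_ (hqp 1 (qpAlg _).one_mem) ?_ hf
  · rintro f ((⟨φ, rfl⟩ | hf) | ⟨φ, rfl⟩)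
    · exact hqp _ (hom_mem_qpAlg φ)
    · exact hqp _ (periodic_mem_qpAlg hf)
    · obtain ⟨a, c, rfl⟩ := exists_eq_linHom φ
      rcases lt_trichotomy c 0 with hc | rfl | hc
      -- An upper bound on `t` is the complement of a lower bound, weak becoming strict.
      · have h := Submodule.sub_mem _ (hqp 1 (qpAlg _).one_mem)
          (hstep _ (.strict (-a) c.natAbs (by omega)))
        refine (congrArg (· ∈ Submodule.span ℚ _) (funext fun x => ?_)).mpr h
        have e : (-a) x.1 = -a x.1 := rfl
        simp only [Pi.sub_apply, Pi.one_apply, one_sub_ite]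
        have e2 : ((c.natAbs : ℕ) : ℤ) = -c := by omega
        by_cases h' : 0 ≤ linHom a c x
        · rw [if_pos h', if_neg]
          rw [linHom_apply] at h'
          rw [e, e2]
          linarith
        · rw [if_neg h', if_pos]
          rw [linHom_apply] at h'
          rw [e, e2]
          linarith
      · refine Submodule.subset_span ⟨_, indicator_mem_pqAlg a, 1, (qpAlg _).one_mem, 1, .one, ?_⟩
        ext x
        simp
      · lift c to ℕ using hc.le
        exact hstep _ (.weak a c (by omega))
  · rintro _ ⟨a, ha, w, hw, u, hu, rfl⟩ _ ⟨a', ha', w', hw', u', hu', rfl⟩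
    obtain ⟨κ, hκ, h⟩ := hu.mul hu'
    have haa := (pqAlg G).mul_mem ha ha'
    have hww := (qpAlg _).mul_mem hw hw'
    have h₁ := Submodule.add_mem _
      (Submodule.subset_span (R := ℚ) (s := {f : G × ℤ → ℚ | ∃ a ∈ pqAlg G,
        ∃ w ∈ qpAlg (G × ℤ), ∃ u, IsStep u ∧ f = fun x => a x.1 * (w x * u x)})
        ⟨_, (pqAlg G).mul_mem hκ haa, _, hww, u, hu, rfl⟩)
      (Submodule.subset_span ⟨_, (pqAlg G).mul_mem ((pqAlg G).sub_mem (pqAlg G).one_mem hκ) haa,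
        _, hww, u', hu', rfl⟩)
    convert h₁ using 1
    ext x
    simp only [Pi.mul_apply, Pi.add_apply, Pi.sub_apply, Pi.one_apply]
    linear_combination (a x.1 * a' x.1 * w x * w' x) * h x

/-- A quasi-polynomial function, cut off below at a rational linear threshold, has a piecewise
quasi-polynomial antidifference. -/
theorem exists_antidifference_cutoff {w : G × ℤ → ℚ} (hw : w ∈ qpAlg (G × ℤ)) {ℓ : G → ℤ}
    (hℓ : ∀ f ∈ qpAlg (G × ℤ), (fun x => f (x, ℓ x - 1)) ∈ qpAlg G)
    (hu : (fun x : G × ℤ => if ℓ x.1 ≤ x.2 then (1 : ℚ) else 0) ∈ pqAlg (G × ℤ)) :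
    ∃ F ∈ pqAlg (G × ℤ), ∀ x t, F (x, t) - F (x, t - 1) = w (x, t) * if ℓ x ≤ t then 1 else 0 := by
  obtain ⟨W, hW, h⟩ := exists_antidifference_qpAlg hw
  -- The antidifference `W(x, t) - W(x, ℓ x - 1)` is normalised to vanish at `t = ℓ x - 1`, so that
  -- cutting it off at `ℓ x` creates no jump.
  refine ⟨_, (pqAlg _).mul_mem hu ((pqAlg _).sub_mem (qpAlg_le_pqAlg hW)
    (fst_mem_pqAlg (qpAlg_le_pqAlg (hℓ W hW)))), fun x t => ?_⟩
  simp only [Pi.mul_apply, Pi.sub_apply, ← h]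
  rcases lt_trichotomy t (ℓ x) with h' | rfl | h'
  · rw [if_neg (by omega), if_neg (by omega)]
    ring
  · rw [if_pos le_rfl, if_neg (by omega)]
    ring
  · rw [if_pos (by omega), if_pos (by omega)]
    ring

/-- The threshold is `⌈-a/c⌉`, written as `-⌊a/c⌋` because integer division rounds down. -/
theorem weak_iff (a t : ℤ) (c : ℕ) (hc : 0 < c) :
    0 ≤ a + c * t ↔ -(a / (c : ℤ)) ≤ t := by
  have hc' : (0 : ℤ) < c := by exact_mod_cast hc
  rw [neg_le, Int.le_ediv_iff_mul_le hc']
  constructor <;> intro h <;> linarith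

theorem strict_iff (a t : ℤ) (c : ℕ) (hc : 0 < c) :
    0 < a + c * t ↔ (-a) / (c : ℤ) + 1 ≤ t := by
  have hc' : (0 : ℤ) < c := by exact_mod_cast hc
  rw [Int.add_one_le_iff, Int.ediv_lt_iff_lt_mul hc']
  constructor <;> intro h <;> linarith

/-- Piecewise quasi-polynomial functions have piecewise quasi-polynomial antidifferences. -/
theorem exists_antidifference_pqAlg {f : G × ℤ → ℚ} (hf : f ∈ pqAlg (G × ℤ)) :
    ∃ F ∈ pqAlg (G × ℤ), ∀ x t, F (x, t) - F (x, t - 1) = f (x, t) := by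
  have hspan := pqAlg_subset_span hf
  clear hf
  induction hspan using Submodule.span_induction with
  | mem f hf =>
    obtain ⟨a, ha, w, hw, u, hu, rfl⟩ := hf
    have : ∃ F ∈ pqAlg (G × ℤ), ∀ x t, F (x, t) - F (x, t - 1) = w (x, t) * u (x, t) := by
      cases hu' : hu with
      | one =>
        obtain ⟨W, hW, h⟩ := exists_antidifference_qpAlg hw
        exact ⟨W, qpAlg_le_pqAlg hW, by simpa using h⟩
      | weak b c hc =>
        have hm := hu.mem_pqAlg
        simp only [weak_iff _ _ _ hc] at hm ⊢
        refine exists_antidifference_cutoff hw (ℓ := fun x => -(b x / (c : ℤ))) ?_ hm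
        intro f hf
        have := comp_ediv_mem_qpAlg b c hc 1 (comp_hom_mem_qpAlg
          (AddMonoidHom.prodMap (AddMonoidHom.id G) (-AddMonoidHom.id ℤ)) hf)
        convert this using 3
        simp
        ring
      | strict b c hc =>
        have hm := hu.mem_pqAlg
        simp only [strict_iff _ _ _ hc] at hm ⊢
        refine exists_antidifference_cutoff hw (ℓ := fun x => (-b x) / (c : ℤ) + 1) ?_ hm
        intro f hf
        have := comp_ediv_mem_qpAlg (-b) c hc 0 hf
        simpa using this
    obtain ⟨F, hF, h⟩ := this
    refine ⟨_, (pqAlg _).mul_mem (fst_mem_pqAlg ha) hF, fun x t => ?_⟩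
    simp only [Pi.mul_apply, ← h]
    ring
  | zero => exact ⟨0, (pqAlg _).zero_mem, by simp⟩
  | add f g _ _ hf hg =>
    obtain ⟨F, hF, h⟩ := hf
    obtain ⟨F', hF', h'⟩ := hg
    refine ⟨F + F', (pqAlg _).add_mem hF hF', fun x t => ?_⟩
    simp only [Pi.add_apply, ← h, ← h']
    ring
  | smul c f _ hf =>
    obtain ⟨F, hF, h⟩ := hf
    refine ⟨c • F, (pqAlg _).smul_mem hF c, fun x t => ?_⟩
    simp only [Pi.smul_apply, ← h, smul_eq_mul]
    ring

theorem sum_Ioc_eq_sub {F f : ℤ → ℚ} (h : ∀ t, F t - F (t - 1) = f t) {a b : ℤ} (hab : a ≤ b) :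
    ∑ t ∈ Finset.Ioc a b, f t = F b - F a := by
  induction b, hab using Int.leInduction with
  | base => simp
  | succ b hb ih =>
    have : Finset.Ioc a (b + 1) = insert (b + 1) (Finset.Ioc a b) := by
      ext t
      simp only [Finset.mem_Ioc, Finset.mem_insert]
      omega
    rw [this, Finset.sum_insert (by simp), ih, ← h]
    simp

/-- Summation over a variable in a range bounded by linear functions. -/
theorem sum_Ioc_mem_pqAlg {f : G × ℤ → ℚ} (hf : f ∈ pqAlg (G × ℤ)) (ψ : G →+ ℤ) :
    (fun x => ∑ t ∈ Finset.Ioc (-ψ x) (ψ x), f (x, t)) ∈ pqAlg G := by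
  obtain ⟨F, hF, h⟩ := exists_antidifference_pqAlg hf
  have h₁ := comp_hom_mem_pqAlg ((AddMonoidHom.id G).prod ψ) hF
  have h₂ := comp_hom_mem_pqAlg ((AddMonoidHom.id G).prod (-ψ)) hF
  -- The indicator is needed where `ψ x < 0`: there the range is empty, but `F (x, ψ x) - F (x, -ψ
  -- x)` need not vanish.
  convert (pqAlg G).mul_mem (indicator_mem_pqAlg ψ) ((pqAlg G).sub_mem h₁ h₂) using 1
  ext x
  simp only [Pi.mul_apply, Pi.sub_apply]
  by_cases hx : 0 ≤ ψ x
  · rw [if_pos hx, one_mul, sum_Ioc_eq_sub (F := fun t => F (x, t)) (h x) (by omega)]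
    rfl
  · rw [if_neg hx, zero_mul, Finset.Ioc_eq_empty (by omega), Finset.sum_empty]

/-- The coordinates are summed out one by one; the bound depends only on `x`, so it remains a
homomorphism in the variables still present. -/
theorem sum_piFinset_mem_pqAlg {d : ℕ} {f : G × (Fin d → ℤ) → ℚ}
    (hf : f ∈ pqAlg (G × (Fin d → ℤ))) (ψ : G →+ ℤ) :
    (fun x => ∑ z ∈ Fintype.piFinset fun _ : Fin d => Finset.Ioc (-ψ x) (ψ x), f (x, z)) ∈
      pqAlg G := by
  induction d with
  | zero =>
    convert comp_hom_mem_pqAlg ((AddMonoidHom.id G).prod (0 : G →+ (Fin 0 → ℤ))) hf using 2 with x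
    have : (Fintype.piFinset fun _ : Fin 0 => Finset.Ioc (-ψ x) (ψ x)) = {0} := by
      ext z
      simp only [Fintype.mem_piFinset, IsEmpty.forall_iff, Finset.mem_singleton, true_iff]
      exact Subsingleton.elim _ _
    rw [this, Finset.sum_singleton]
    rfl
  | succ d ih =>
    let cons : (G × (Fin d → ℤ)) × ℤ →+ G × (Fin (d + 1) → ℤ) :=
      { toFun := fun x => (x.1.1, Fin.cons x.2 x.1.2)
        map_zero' := by
          refine Prod.ext rfl (funext fun i => ?_)
          refine Fin.cases ?_ (fun i => ?_) i <;> rfl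
        map_add' := fun x y => by
          refine Prod.ext rfl (funext fun i => ?_)
          refine Fin.cases ?_ (fun i => ?_) i <;> rfl }
    have h := ih (sum_Ioc_mem_pqAlg (comp_hom_mem_pqAlg cons hf)
      (ψ.comp (AddMonoidHom.fst G (Fin d → ℤ))))
    convert h using 2 with x
    change _ = ∑ z ∈ Fintype.piFinset fun _ : Fin d => Finset.Ioc (-ψ x) (ψ x),
      ∑ t ∈ Finset.Ioc (-ψ x) (ψ x), f (cons ((x, z), t))
    rw [← Finset.sum_product']
    refine Finset.sum_bij' (fun z _ => (Fin.tail z, z 0)) (fun z _ => Fin.cons z.2 z.1) ?_ ?_ ?_ ?_ ?_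
    · intro z hz
      simp only [Fintype.mem_piFinset, Finset.mem_product] at hz ⊢
      exact ⟨fun i => hz i.succ, hz 0⟩
    · intro z hz
      simp only [Fintype.mem_piFinset, Finset.mem_product] at hz ⊢
      intro i
      refine Fin.cases ?_ (fun i => ?_) i
      · exact hz.2
      · exact hz.1 i
    · intro z _
      simp
    · intro z _
      simp
    · intro z _
      simp [cons]

/-- On the positive integers, a piecewise quasi-polynomial function is quasi-polynomial. -/
theorem exists_qpAlg_eq_of_pos {f : ℤ → ℚ} (hf : f ∈ pqAlg ℤ) :
    ∃ g ∈ qpAlg ℤ, ∀ n, 0 < n → f n = g n := by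
  induction hf using Algebra.adjoin_induction with
  | mem f hf =>
    rcases hf with hf | ⟨φ, rfl⟩
    · exact ⟨f, Algebra.subset_adjoin hf, fun _ _ => rfl⟩
    · refine ⟨_, const_mem_qpAlg (if 0 ≤ φ 1 then 1 else 0), fun n hn => ?_⟩
      have : φ n = n * φ 1 := by
        conv_lhs => rw [show n = n • (1 : ℤ) by simp, map_zsmul]
        simp
      simp only [this, mul_nonneg_iff_of_pos_left hn]
  | algebraMap r => exact ⟨_, (qpAlg ℤ).algebraMap_mem r, fun _ _ => rfl⟩
  | add f g _ _ hf hg =>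
    obtain ⟨F, hF, h⟩ := hf
    obtain ⟨F', hF', h'⟩ := hg
    exact ⟨_, (qpAlg ℤ).add_mem hF hF', fun n hn => by simp [h n hn, h' n hn]⟩
  | mul f g _ _ hf hg =>
    obtain ⟨F, hF, h⟩ := hf
    obtain ⟨F', hF', h'⟩ := hg
    exact ⟨_, (qpAlg ℤ).mul_mem hF hF', fun n hn => by simp [h n hn, h' n hn]⟩

/-- A quasi-polynomial function on `ℤ` is given by polynomials on residue classes. -/
theorem exists_polynomial_of_mem_qpAlg {f : ℤ → ℚ} (hf : f ∈ qpAlg ℤ) :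
    ∃ p : ℕ, 0 < p ∧ ∃ P : ZMod p → ℚ[X], ∀ n : ℤ, f n = (P n).eval (n : ℚ) := by
  have cast_cast : ∀ (p q : ℕ) (n : ℤ), ((n : ZMod (p * q)).cast : ZMod p) = n := fun p q n =>
    ZMod.cast_intCast (dvd_mul_right p q) n
  have cast_cast' : ∀ (p q : ℕ) (n : ℤ), ((n : ZMod (p * q)).cast : ZMod q) = n := fun p q n =>
    ZMod.cast_intCast (dvd_mul_left q p) n
  induction hf using Algebra.adjoin_induction with
  | mem f hf =>
    rcases hf with ⟨φ, rfl⟩ | ⟨p, hp, h⟩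
    · refine ⟨1, one_pos, fun _ => Polynomial.C (φ 1 : ℚ) * Polynomial.X, fun n => ?_⟩
      have : φ n = n * φ 1 := by
        conv_lhs => rw [show n = n • (1 : ℤ) by simp, map_zsmul]
        simp
      simp [this, mul_comm]
    · have : NeZero p := ⟨hp.ne'⟩
      refine ⟨p, hp, fun r => Polynomial.C (f (r.val : ℤ)), fun n => ?_⟩
      rw [Polynomial.eval_C, ZMod.val_intCast]
      have := h (n % p) (n / p)
      rw [← this]
      congr 1
      simp [Int.emod_add_mul_ediv]
  | algebraMap r => exact ⟨1, one_pos, fun _ => Polynomial.C r, fun n => by simp⟩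
  | add f g _ _ hf hg =>
    obtain ⟨p, hp, P, h⟩ := hf
    obtain ⟨q, hq, Q, h'⟩ := hg
    refine ⟨p * q, by positivity, fun r => P r.cast + Q r.cast, fun n => ?_⟩
    simp only [Pi.add_apply, Polynomial.eval_add, cast_cast, cast_cast', h, h']
  | mul f g _ _ hf hg =>
    obtain ⟨p, hp, P, h⟩ := hf
    obtain ⟨q, hq, Q, h'⟩ := hg
    refine ⟨p * q, by positivity, fun r => P r.cast * Q r.cast, fun n => ?_⟩
    simp only [Pi.mul_apply, Polynomial.eval_mul, cast_cast, cast_cast', h, h']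

end PiecewiseSummation

/-! ### Second differences of lattice point counts -/

section SecondDifferences

open Asymptotics Filter

variable {ι : Type*}

/-- If the mixed second differences of `N` in two different coordinate directions are small, and
`N` is invariant under translations with arbitrary `k`-th coordinate, for each `k`, then all mixed
second differences of `N` are small. -/
theorem isBigO_second_difference [Finite ι] [DecidableEq ι] (N : (ι → ℤ) → ℝ) (b : ℕ → ι → ℤ) (g : ℕ → ℝ)
    (hmixed : ∀ k l, k ≠ l → ∀ e, (fun n => N (b n + e + Pi.single k 1 + Pi.single l 1) -
      N (b n + e + Pi.single k 1) - N (b n + e + Pi.single l 1) + N (b n + e)) =O[atTop] g)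
    (hinv : ∀ k, ∃ w : ι → ℤ, w k = 1 ∧ ∀ c, N (c + w) = N c) (v v' e : ι → ℤ) :
    (fun n => N (b n + e + v + v') - N (b n + e + v) - N (b n + e + v') + N (b n + e))
      =O[atTop] g := by
  have := Fintype.ofFinite ι
  -- Quantifying over all offsets `e` makes this a group: the difference in direction `v₁ + v₂` is
  -- the one for `v₁` based at `e + v₂` plus the one for `v₂` based at `e`.
  let A : (ι → ℤ) → AddSubgroup (ι → ℤ) := fun v' =>
    { carrier := {v | ∀ e, (fun n => N (b n + e + v + v') - N (b n + e + v) - N (b n + e + v') +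
        N (b n + e)) =O[atTop] g}
      zero_mem' := fun e => by simpa using isBigO_zero _ _
      add_mem' := fun {v₁ v₂} h₁ h₂ e => by
        refine ((h₁ (e + v₂)).add (h₂ e)).congr_left fun n => ?_
        rw [show b n + (e + v₂) + v₁ + v' = b n + e + (v₁ + v₂) + v' by abel,
          show b n + (e + v₂) + v₁ = b n + e + (v₁ + v₂) by abel,
          show b n + (e + v₂) + v' = b n + e + v₂ + v' by abel,
          show b n + (e + v₂) = b n + e + v₂ by abel]
        ring
      neg_mem' := fun {v} h e => by
        refine (h (e - v)).neg_left.congr_left fun n => ?_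
        rw [show b n + (e - v) + v + v' = b n + e + v' by abel,
          show b n + (e - v) + v = b n + e by abel,
          show b n + (e - v) + v' = b n + e + -v + v' by abel,
          show b n + (e - v) = b n + e + -v by abel]
        ring }
  have hsymm : ∀ v v', v ∈ A v' → v' ∈ A v := by
    intro v v' h e
    refine (h e).congr_left fun n => ?_
    rw [show b n + e + v + v' = b n + e + v' + v by abel]
    ring
  have hsum : ∀ (B : AddSubgroup (ι → ℤ)) (w : ι → ℤ) (s : Finset ι),
      (∀ k ∈ s, Pi.single k 1 ∈ B) → ∑ k ∈ s, w k • Pi.single k 1 ∈ B := fun B w s h =>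
    B.sum_mem fun k hk => B.zsmul_mem (h k hk) _
  have heq : ∀ w : ι → ℤ, w = ∑ k, w k • (Pi.single k 1 : ι → ℤ) := by
    intro w
    ext j
    simp [Finset.sum_apply, Pi.single_apply]
  -- The period `w` has zero second difference with everything and `k`-th coordinate `1`.
  -- Subtracting its other coordinates, whose mixed differences with `k` are small, leaves the
  -- `k`-th unit vector.
  have hself : ∀ k, Pi.single k 1 ∈ A (Pi.single k 1) := by
    intro k
    obtain ⟨w, hwk, hw⟩ := hinv k
    have h₁ : w ∈ A (Pi.single k 1) := by
      intro e
      refine (isBigO_zero g atTop).congr_left fun n => ?_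
      rw [show b n + e + w + Pi.single k 1 = b n + e + Pi.single k 1 + w by abel, hw, hw]
      ring
    have h₂ := heq w
    rw [← Finset.add_sum_erase _ _ (Finset.mem_univ k), hwk, one_smul] at h₂
    have h₃ := (A (Pi.single k 1)).sub_mem h₁ (hsum _ w (Finset.univ.erase k) fun l hl => ?_)
    · rwa [← eq_sub_of_add_eq h₂.symm] at h₃
    · exact hmixed l k (Finset.ne_of_mem_erase hl)
  have hbasis : ∀ k l, Pi.single l 1 ∈ A (Pi.single k 1) := by
    intro k l
    by_cases h : l = k
    · exact h ▸ hself l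
    · exact hmixed l k h
  have h₁ : ∀ k v, v ∈ A (Pi.single k 1) := fun k v => by
    rw [heq v]
    exact hsum _ _ _ fun l _ => hbasis k l
  have h₂ : v' ∈ A v := by
    rw [heq v']
    exact hsum _ _ _ fun l _ => hsymm _ _ (h₁ l v)
  exact hsymm _ _ h₂ e

variable {d : ℕ}

/-- The lattice points of the polyhedron `τ z ≤ b`. -/
def latticePoints (τ : ι → Fin d → ℤ) (b : ι → ℤ) : Set (Fin d → ℤ) :=
  {z | ∀ l, dotProduct (τ l) z ≤ b l}

theorem finite_of_abs_le {S : Set (Fin d → ℤ)} {R : ℤ} (h : ∀ z ∈ S, ∀ j, |z j| ≤ R) :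
    S.Finite := by
  refine (Set.finite_Icc (fun _ : Fin d => -R) (fun _ => R)).subset fun z hz => ?_
  exact ⟨fun j => (abs_le.1 (h z hz j)).1, fun j => (abs_le.1 (h z hz j)).2⟩

/-- A box contains few lattice points on an affine subspace of codimension two. -/
theorem ncard_codim_two_le {S : Set (Fin d → ℤ)} {R : ℕ} (h : ∀ z ∈ S, ∀ j, |z j| ≤ R)
    {a a' : Fin d → ℤ} {c c' : ℤ} (ha : ∀ z ∈ S, dotProduct a z = c)
    (ha' : ∀ z ∈ S, dotProduct a' z = c') {j₁ j₂ : Fin d}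
    (hminor : a j₁ * a' j₂ - a j₂ * a' j₁ ≠ 0) : S.ncard ≤ (2 * R + 1) ^ (d - 2) := by
  have hne : j₁ ≠ j₂ := by
    rintro rfl
    exact hminor (by ring)
  let T : Finset ({j : Fin d // j ≠ j₁ ∧ j ≠ j₂} → ℤ) :=
    Fintype.piFinset fun _ => Finset.Icc (-(R : ℤ)) R
  have hT : T.card = (2 * R + 1) ^ (d - 2) := by
    simp only [T]
    rw [Fintype.card_piFinset, Finset.prod_const, Int.card_Icc, Finset.card_univ]
    congr 1
    · omega
    · rw [Fintype.card_subtype]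
      have : Finset.univ.filter (fun j : Fin d => j ≠ j₁ ∧ j ≠ j₂) =
          (Finset.univ.erase j₁).erase j₂ := by
        ext j
        simp [and_comm]
      rw [this, Finset.card_erase_of_mem (by simp [hne.symm]), Finset.card_erase_of_mem (by simp)]
      simp
      omega
  rw [← hT, ← Set.ncard_coe_finset]
  -- Forgetting the coordinates `j₁` and `j₂` is injective on `S`: by Cramer's rule the two
  -- equations determine them from the others.
  refine Set.ncard_le_ncard_of_injOn (fun z j => z j.1) ?_ ?_ (Finset.finite_toSet T)
  · intro z hz
    simp only [T, Fintype.coe_piFinset, Set.mem_pi, Finset.coe_Icc, Set.mem_Icc]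
    exact fun j _ => abs_le.1 (h z hz j)
  · intro z hz z' hz' hzz
    have hzero : ∀ j, j ≠ j₁ ∧ j ≠ j₂ → z j - z' j = 0 := fun j hj =>
      sub_eq_zero.2 (congrFun hzz ⟨j, hj⟩)
    have key : ∀ (a : Fin d → ℤ), dotProduct a z = dotProduct a z' →
        a j₁ * (z j₁ - z' j₁) + a j₂ * (z j₂ - z' j₂) = 0 := by
      intro a h
      rw [← sub_eq_zero, ← dotProduct_sub] at h
      rw [← h, dotProduct, Finset.sum_eq_add j₁ j₂ hne]
      · rfl
      · intro j _ hj
        simp [hzero j hj]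
      · simp
      · simp
    have e₁ := key a ((ha z hz).trans (ha z' hz').symm)
    have e₂ := key a' ((ha' z hz).trans (ha' z' hz').symm)
    have y₁ : z j₁ - z' j₁ = 0 := by
      refine (mul_eq_zero.1 (?_ : (a j₁ * a' j₂ - a j₂ * a' j₁) * (z j₁ - z' j₁) = 0)).resolve_left
        hminor
      linear_combination a' j₂ * e₁ - a j₂ * e₂
    have y₂ : z j₂ - z' j₂ = 0 := by
      refine (mul_eq_zero.1 (?_ : (a j₁ * a' j₂ - a j₂ * a' j₁) * (z j₂ - z' j₂) = 0)).resolve_left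
        hminor
      linear_combination a j₁ * e₂ - a' j₁ * e₁
    ext j
    by_cases h₁ : j = j₁
    · subst h₁; omega
    by_cases h₂ : j = j₂
    · subst h₂; omega
    have := hzero j ⟨h₁, h₂⟩
    omega

variable {τ : ι → Fin d → ℤ} {C : ℕ}

theorem finite_latticePoints [Finite ι]
    (hC : ∀ (R : ℕ) (z : Fin d → ℤ), (∀ l, dotProduct (τ l) z ≤ R) → ∀ j, |z j| ≤ C * R)
    (b : ι → ℤ) : (latticePoints τ b).Finite := by
  have := Fintype.ofFinite ι
  refine finite_of_abs_le (R := C * ((∑ l, (b l).natAbs : ℕ) : ℤ)) fun z hz => hC _ z fun l => ?_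
  have h₁ : (b l).natAbs ≤ ∑ l, (b l).natAbs :=
    Finset.single_le_sum (f := fun l => (b l).natAbs) (fun _ _ => Nat.zero_le _) (Finset.mem_univ l)
  have h₂ := hz l
  omega

/-- By integrality, raising a bound by one admits only points with equality in the new bound. -/
theorem latticePoints_diff [DecidableEq ι] (b : ι → ℤ) (k : ι) :
    latticePoints τ (b + Pi.single k 1) \ latticePoints τ b =
      {z ∈ latticePoints τ (b + Pi.single k 1) | dotProduct (τ k) z = b k + 1} := by
  ext z
  simp only [latticePoints, Set.mem_sdiff, Set.mem_ofPred_eq]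
  refine and_congr_right fun h => ?_
  have hk := h k
  simp only [Pi.add_apply, Pi.single_eq_same] at hk
  constructor
  · intro h'
    by_contra hne
    refine h' fun l => ?_
    by_cases hl : l = k
    · subst hl
      omega
    · simpa [hl] using h l
  · intro h' h''
    have := h'' k
    omega

theorem latticePoints_mono {b b' : ι → ℤ} (h : b ≤ b') : latticePoints τ b ⊆ latticePoints τ b' :=
  fun _ hz l => (hz l).trans (h l)

theorem le_add_single [DecidableEq ι] (b : ι → ℤ) (k : ι) : b ≤ b + Pi.single k 1 :=
  le_add_of_nonneg_right (by simp [Pi.single_nonneg])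

/-- The mixed second difference of the number of lattice points in different coordinate directions
is the number of lattice points on a face of codimension two. -/
theorem second_difference_ncard [DecidableEq ι] (hfin : ∀ b, (latticePoints τ b).Finite) (b : ι → ℤ) {k l : ι}
    (hkl : k ≠ l) :
    ((latticePoints τ (b + Pi.single k 1 + Pi.single l 1)).ncard : ℝ) -
      (latticePoints τ (b + Pi.single k 1)).ncard - (latticePoints τ (b + Pi.single l 1)).ncard +
      (latticePoints τ b).ncard =
    {z ∈ latticePoints τ (b + Pi.single k 1 + Pi.single l 1) |
      dotProduct (τ k) z = b k + 1 ∧ dotProduct (τ l) z = b l + 1}.ncard := by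
  have step : ∀ b k, ((latticePoints τ (b + Pi.single k 1)).ncard : ℝ) =
      (latticePoints τ b).ncard +
        {z ∈ latticePoints τ (b + Pi.single k 1) | dotProduct (τ k) z = b k + 1}.ncard := by
    intro b k
    rw [← latticePoints_diff, add_comm ((latticePoints τ b).ncard : ℝ)]
    exact_mod_cast (Set.ncard_sdiff_add_ncard_of_subset
      (latticePoints_mono (le_add_single b k)) (hfin _)).symm
  have e₁ := step (b + Pi.single k 1 : ι → ℤ) l
  have e₂ := step b l
  set A := {z ∈ latticePoints τ (b + Pi.single k 1 + Pi.single l 1) |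
    dotProduct (τ l) z = (b + Pi.single k 1 : ι → ℤ) l + 1} with hA
  set B := {z ∈ latticePoints τ (b + Pi.single l 1) | dotProduct (τ l) z = b l + 1} with hB
  have hl : (b + Pi.single k 1 : ι → ℤ) l = b l := by simp [hkl.symm]
  have hBA : B ⊆ A := by
    intro z hz
    refine ⟨latticePoints_mono ?_ hz.1, by rw [hl]; exact hz.2⟩
    rw [add_right_comm]
    exact le_add_single _ _
  -- `A` and `B` are the increments in direction `l` at `b + Pi.single k 1` and at `b`. Their
  -- difference consists of the points that need the raised `k`-th bound, hence attain it.
  have hAB : A \ B = {z ∈ latticePoints τ (b + Pi.single k 1 + Pi.single l 1) |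
      dotProduct (τ k) z = b k + 1 ∧ dotProduct (τ l) z = b l + 1} := by
    have hd := latticePoints_diff (τ := τ) (b + Pi.single l 1 : ι → ℤ) k
    have hk : (b + Pi.single l 1 : ι → ℤ) k = b k := by simp [hkl]
    rw [hk, add_right_comm] at hd
    ext z
    have hz := Set.ext_iff.1 hd z
    simp only [Set.mem_sdiff, Set.mem_ofPred_eq] at hz
    simp only [hA, hB, hl, Set.mem_sdiff, Set.mem_ofPred_eq]
    tauto
  have hAf : A.Finite := (hfin _).subset fun z hz => hz.1
  have e₃ : ((A \ B).ncard : ℝ) + B.ncard = A.ncard := by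
    exact_mod_cast Set.ncard_sdiff_add_ncard_of_subset hBA hAf
  rw [hAB] at e₃
  linarith

/-- Either the two forms are independent and the face lies in a box of side `O(n)` in codimension
two, or, for parallel hyperplanes moving apart, the face is eventually empty. -/
theorem isBigO_mixed_difference [Finite ι] [DecidableEq ι]
    (hC : ∀ (R : ℕ) (z : Fin d → ℤ), (∀ l, dotProduct (τ l) z ≤ R) → ∀ j, |z j| ≤ C * R)
    (β e : ι → ℤ) {k l : ι} (hkl : k ≠ l)
    (h : (∃ j₁ j₂, τ k j₁ * τ l j₂ - τ k j₂ * τ l j₁ ≠ 0) ∨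
      ∀ᶠ n : ℕ in atTop, ∀ z, ¬(dotProduct (τ k) z = n * β k + e k + 1 ∧
        dotProduct (τ l) z = n * β l + e l + 1)) :
    (fun n : ℕ => ((latticePoints τ ((n • β) + e + Pi.single k 1 + Pi.single l 1)).ncard : ℝ) -
      (latticePoints τ ((n • β) + e + Pi.single k 1)).ncard -
      (latticePoints τ ((n • β) + e + Pi.single l 1)).ncard + (latticePoints τ ((n • β) + e)).ncard)
      =O[atTop] fun n : ℕ => (n : ℝ) ^ ((d : ℤ) - 2) := by
  have := Fintype.ofFinite ι
  simp_rw [second_difference_ncard (finite_latticePoints hC) _ hkl]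
  rcases h with ⟨j₁, j₂, hminor⟩ | h
  -- For `d ≤ 1` there is no nonzero minor; so the integer exponent `d - 2` agrees with the
  -- truncated one.
  · have hd : 2 ≤ d := by
      by_contra hd
      have : j₁ = j₂ := by
        ext
        omega
      subst this
      exact hminor (by ring)
    -- Chosen so that `K (n + 1)` exceeds every bound; the `2` absorbs the two unit increments.
    set K : ℕ := ∑ m, ((β m).natAbs + (e m).natAbs + 2) with hK
    refine IsBigO.of_bound (((2 * (C * K) + 1) * 2 : ℕ) ^ (d - 2) : ℝ) ?_
    filter_upwards [eventually_ge_atTop 1] with n hn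
    have hbox : ∀ z ∈ {z ∈ latticePoints τ ((n • β) + e + Pi.single k 1 + Pi.single l 1) |
        dotProduct (τ k) z = ((n • β) + e) k + 1 ∧ dotProduct (τ l) z = ((n • β) + e) l + 1},
        ∀ j, |z j| ≤ (C * (K * (n + 1)) : ℕ) := by
      rintro z ⟨hz, -⟩
      rw [Nat.cast_mul]
      refine hC (K * (n + 1)) z fun m => (hz m).trans ?_
      have h₁ : (β m).natAbs + (e m).natAbs + 2 ≤ K := Finset.single_le_sum
        (f := fun m => (β m).natAbs + (e m).natAbs + 2) (fun _ _ => Nat.zero_le _)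
        (Finset.mem_univ m)
      have h₂ : ∀ k : ι, (Pi.single k 1 : ι → ℤ) m ≤ 1 := by
        intro k
        rw [Pi.single_apply]
        split_ifs <;> simp
      have h₃ := h₂ k
      have h₄ := h₂ l
      have h₅ : (n : ℤ) * β m ≤ n * (β m).natAbs := by
        gcongr
        omega
      have h₁' : (((β m).natAbs + (e m).natAbs + 2 : ℕ) : ℤ) ≤ K := by exact_mod_cast h₁
      have h₆ : ((β m).natAbs + (e m).natAbs + 2 : ℕ) * (n + 1 : ℤ) ≤ K * (n + 1) := by gcongr
      have h₇ : (0 : ℤ) ≤ ((e m).natAbs + 2) * n := by positivity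
      have h₈ : ((n • β + e + Pi.single k 1 + Pi.single l 1 : ι → ℤ)) m =
          n * β m + e m + (Pi.single k 1 : ι → ℤ) m + (Pi.single l 1 : ι → ℤ) m := by simp
      rw [h₈]
      push_cast at *
      nlinarith [le_abs_self (e m), abs_nonneg (β m)]
    have hcard := ncard_codim_two_le hbox (fun z hz => hz.2.1) (fun z hz => hz.2.2) hminor
    have hpow : (n : ℝ) ^ ((d : ℤ) - 2) = (n : ℝ) ^ (d - 2) := by
      rw [← zpow_natCast]
      congr 1
      omega
    rw [hpow, Real.norm_natCast, Real.norm_of_nonneg (by positivity), ← mul_pow]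
    have hle : 2 * (C * (K * (n + 1))) + 1 ≤ (2 * (C * K) + 1) * 2 * n := by
      have h₁ : C * K * 1 ≤ C * K * n := Nat.mul_le_mul_left _ hn
      have h₂ : C * (K * (n + 1)) = C * K * n + C * K := by ring
      rw [h₂]
      nlinarith
    calc _ ≤ (((2 * (C * (K * (n + 1))) + 1) ^ (d - 2) : ℕ) : ℝ) := by exact_mod_cast hcard
      _ ≤ (((2 * (C * K) + 1) * 2 * n) ^ (d - 2) : ℕ) := by
        exact_mod_cast Nat.pow_le_pow_left hle _
      _ = _ := by push_cast; ring
  · refine (isBigO_zero _ _).congr' ?_ EventuallyEq.rfl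
    filter_upwards [h] with n hn
    have : {z ∈ latticePoints τ ((n • β) + e + Pi.single k 1 + Pi.single l 1) |
        dotProduct (τ k) z = ((n • β) + e) k + 1 ∧ dotProduct (τ l) z = ((n • β) + e) l + 1} = ∅ := by
      ext z
      simp only [Set.mem_ofPred_eq, Set.mem_empty_iff_false, iff_false]
      rintro ⟨-, hz⟩
      exact hn z (by simpa using hz)
    rw [this]
    simp

/-- Translation by `w` is a bijection between the two sets. With primitive forms this supplies the
invariance required by `isBigO_second_difference`. -/
theorem ncard_latticePoints_add (b : ι → ℤ) (w : Fin d → ℤ) :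
    (latticePoints τ (b + fun l => dotProduct (τ l) w)).ncard = (latticePoints τ b).ncard := by
  rw [← Set.ncard_image_of_injective (latticePoints τ b) (add_left_injective w)]
  congr 1
  ext z
  simp only [latticePoints, Set.mem_ofPred_eq, Set.mem_image, Pi.add_apply]
  constructor
  · intro h
    refine ⟨z - w, fun l => ?_, by simp⟩
    rw [dotProduct_sub]
    linarith [h l]
  · rintro ⟨y, hy, rfl⟩ l
    rw [dotProduct_add]
    linarith [hy l]

/-- The second difference of the number of lattice points in the dilates `τ z ≤ n β + e`. -/
theorem isBigO_second_difference_ncard [Finite ι]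
    (hC : ∀ (R : ℕ) (z : Fin d → ℤ), (∀ l, dotProduct (τ l) z ≤ R) → ∀ j, |z j| ≤ C * R)
    (hprim : ∀ k, ∃ w, dotProduct (τ k) w = 1) (β e : ι → ℤ)
    (h : ∀ k l, k ≠ l → (∃ j₁ j₂, τ k j₁ * τ l j₂ - τ k j₂ * τ l j₁ ≠ 0) ∨
      ∀ e : ι → ℤ, ∀ᶠ n : ℕ in atTop, ∀ z, ¬(dotProduct (τ k) z = n * β k + e k + 1 ∧
        dotProduct (τ l) z = n * β l + e l + 1)) :
    (fun n : ℕ => ((latticePoints τ ((n + 2) • β + e)).ncard : ℝ) -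
      2 * (latticePoints τ ((n + 1) • β + e)).ncard + (latticePoints τ (n • β + e)).ncard)
      =O[atTop] fun n : ℕ => (n : ℝ) ^ ((d : ℤ) - 2) := by
  classical
  have := isBigO_second_difference (fun b => ((latticePoints τ b).ncard : ℝ)) (fun n : ℕ => n • β)
    (fun n : ℕ => (n : ℝ) ^ ((d : ℤ) - 2))
    (fun k l hkl e => isBigO_mixed_difference hC β e hkl ((h k l hkl).imp_right fun h => h e))
    (fun k => by
      obtain ⟨w, hw⟩ := hprim k
      exact ⟨fun l => dotProduct (τ l) w, hw, fun c => by rw [ncard_latticePoints_add]⟩) β β e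
  refine this.congr_left fun n => ?_
  rw [show n • β + e + β + β = (n + 2) • β + e by rw [add_smul, two_smul]; abel,
    show n • β + e + β = (n + 1) • β + e by rw [add_smul, one_smul]; abel]
  ring

end SecondDifferences

/-! ### Coefficients and integrality of quasi-polynomials -/

section PolynomialAsymptotics

open Asymptotics Filter Topology

theorem isEquivalent_eval_rat (P : ℚ[X]) {x : ℕ → ℕ} (hx : Tendsto x atTop atTop) :
    (fun m => ((P.eval (x m : ℚ) : ℚ) : ℝ)) ~[atTop]
      fun m => (P.leadingCoeff : ℝ) * (x m : ℝ) ^ P.natDegree := by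
  have h := ((P.map (algebraMap ℚ ℝ)).isEquivalent_atTop_lead).comp_tendsto
    ((tendsto_natCast_atTop_atTop (R := ℝ)).comp hx)
  rw [Polynomial.leadingCoeff_map, Polynomial.natDegree_map] at h
  refine h.congr_left (Eventually.of_forall fun m => ?_)
  have := Polynomial.eval_map_algebraMap P ((x m : ℚ) : ℝ)
  simp only [Function.comp_apply]
  have h2 : ((x m : ℕ) : ℝ) = algebraMap ℚ ℝ (x m : ℚ) := by simp
  rw [h2, Polynomial.eval_map_apply]
  simp

/-- A nonzero coefficient beyond `e` makes the degree exceed `e`, and the leading term then outgrows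
the bound. The sequence `x` will run through a residue class; negative `e` is needed for `d < 2`. -/
theorem coeff_eq_zero_of_isBigO {P : ℚ[X]} {x : ℕ → ℕ} (hx : Tendsto x atTop atTop) {e : ℤ}
    (h : (fun m => ((P.eval (x m : ℚ) : ℚ) : ℝ)) =O[atTop] fun m => (x m : ℝ) ^ e) {k : ℕ}
    (hk : e < k) : P.coeff k = 0 := by
  by_contra hne
  have hdeg : e < P.natDegree := hk.trans_le (by exact_mod_cast Polynomial.le_natDegree_of_ne_zero hne)
  have hlead : (P.leadingCoeff : ℝ) ≠ 0 := by
    have : P ≠ 0 := by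
      rintro rfl
      simp at hne
    exact_mod_cast Polynomial.leadingCoeff_ne_zero.2 this
  have h₁ := ((isEquivalent_eval_rat P hx).symm.isBigO.trans h)
  rw [isBigO_const_mul_left_iff hlead] at h₁
  have hx' : Tendsto (fun m => (x m : ℝ)) atTop atTop := tendsto_natCast_atTop_atTop.comp hx
  have h₂ : (fun m => (x m : ℝ) ^ ((P.natDegree : ℤ) - e)) =O[atTop] fun _ => (1 : ℝ) := by
    have := h₁.mul (isBigO_refl (fun m => (x m : ℝ) ^ (-e)) atTop)
    refine this.congr' ?_ ?_
    · filter_upwards [hx'.eventually_gt_atTop 0] with m hm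
      rw [sub_eq_add_neg, zpow_add₀ hm.ne', zpow_natCast]
    · filter_upwards [hx'.eventually_gt_atTop 0] with m hm
      rw [← zpow_add₀ hm.ne']
      simp
  obtain ⟨N, hN⟩ : ∃ N : ℕ, (P.natDegree : ℤ) - e = N + 1 :=
    ⟨((P.natDegree : ℤ) - e - 1).toNat, by omega⟩
  have h₃ : Tendsto (fun m => (x m : ℝ) ^ ((P.natDegree : ℤ) - e)) atTop atTop := by
    rw [hN]
    exact (tendsto_pow_atTop (Nat.succ_ne_zero N)).comp hx'
  exact not_isBoundedUnder_of_tendsto_atTop (tendsto_norm_atTop_atTop.comp h₃)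
    ((isBigO_one_iff ℝ).1 h₂)

/-- A Taylor coefficient is a value of a Hasse derivative, which here is linear. -/
theorem coeff_comp_X_add_C {P : ℚ[X]} {d : ℕ} (hP : P.natDegree ≤ d + 1) (a : ℚ) :
    (P.comp (Polynomial.X + Polynomial.C a)).coeff d =
      P.coeff d + (d + 1) * a * P.coeff (d + 1) := by
  rw [← Polynomial.taylor_apply, Polynomial.taylor_coeff]
  have hdeg : (Polynomial.hasseDeriv d P).natDegree < 2 := by
    have := Polynomial.natDegree_hasseDeriv_le P d
    omega
  rw [Polynomial.eval_eq_sum_range' hdeg]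
  simp [Finset.sum_range_succ, Polynomial.hasseDeriv_coeff, add_comm 1 d]
  ring

/-- Such a `c` is an arithmetic progression that returns to its start after `p` steps, so its slope
is zero. -/
theorem ZMod_const_of_second_difference {p : ℕ} (hp : 0 < p) {c : ZMod p → ℚ}
    (h : ∀ r, c (r + 2) - 2 * c (r + 1) + c r = 0) (r : ZMod p) : c r = c 0 := by
  have : NeZero p := ⟨hp.ne'⟩
  have hlin : ∀ n : ℕ, c n = c 0 + n * (c 1 - c 0) ∧
      c ((n + 1 : ℕ) : ZMod p) = c 0 + (n + 1) * (c 1 - c 0) := by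
    intro n
    induction n with
    | zero => simp
    | succ n ih =>
      refine ⟨by rw [ih.2]; push_cast; ring, ?_⟩
      have := h n
      rw [show ((n : ZMod p) + 2) = ((n + 1 + 1 : ℕ) : ZMod p) by push_cast; ring,
        show ((n : ZMod p) + 1) = ((n + 1 : ℕ) : ZMod p) by push_cast; ring, ih.1, ih.2] at this
      push_cast at this ⊢
      linear_combination this
  have hδ : c 1 - c 0 = 0 := by
    have := (hlin p).1
    rw [ZMod.natCast_self] at this
    have hp' : (p : ℚ) ≠ 0 := by positivity
    simpa [hp'] using this
  have := (hlin r.val).1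
  rwa [ZMod.natCast_zmod_val, hδ, mul_zero, add_zero] at this

/-- A quasi-polynomial of growth rate `V n^d` with second differences of order `n^(d-2)` has
constant coefficients in degrees `d` and `d - 1`. -/
theorem exists_constant_coefficients {d p : ℕ} (hp : 0 < p) {P : ZMod p → ℚ[X]} {L : ℕ → ℝ}
    (hL : ∀ n : ℕ, 0 < n → L n = ((P n).eval (n : ℚ) : ℚ)) {V : ℝ}
    (hV : Tendsto (fun n : ℕ => L n / (n : ℝ) ^ d) atTop (𝓝 V))
    (h2 : (fun n : ℕ => L (n + 2) - 2 * L (n + 1) + L n) =O[atTop]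
      fun n : ℕ => (n : ℝ) ^ ((d : ℤ) - 2)) :
    (∀ r, (P r).natDegree ≤ d) ∧ ∃ vol : ℚ, (vol : ℝ) = V ∧ (∀ r, (P r).coeff d = vol) ∧
      ∀ e, e + 1 = d → ∃ a, ∀ r, (P r).coeff e = a := by
  have : NeZero p := ⟨hp.ne'⟩
  -- This runs through the class of `r`; the extra `p` keeps the argument positive even for `r = 0`,
  -- as `hL` demands.
  have hx : ∀ r : ZMod p, Tendsto (fun m : ℕ => r.val + p * m + p) atTop atTop := fun r =>
    tendsto_atTop_mono (fun m => by
      have := Nat.le_mul_of_pos_left m hp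
      simp only [id]
      omega)
      tendsto_id
  have hcast : ∀ (r : ZMod p) (m : ℕ), ((r.val + p * m + p : ℕ) : ZMod p) = r := by
    intro r m
    simp
  have hLr : ∀ (r : ZMod p) (m : ℕ), L (r.val + p * m + p) =
      ((P r).eval ((r.val + p * m + p : ℕ) : ℚ) : ℚ) := by
    intro r m
    rw [hL _ (by positivity), hcast]
  have hdeg : ∀ r, (P r).natDegree ≤ d := by
    intro r
    rw [Polynomial.natDegree_le_iff_coeff_eq_zero]
    intro k hk
    refine coeff_eq_zero_of_isBigO (hx r) (e := d) ?_ (by exact_mod_cast hk)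
    have h₁ : L =O[atTop] fun n : ℕ => (n : ℝ) ^ d := by
      have := (hV.isBigO_one ℝ).mul (isBigO_refl (fun n : ℕ => (n : ℝ) ^ d) atTop)
      refine this.congr' ?_ (by simp)
      filter_upwards [eventually_gt_atTop 0] with n hn
      have : (n : ℝ) ≠ 0 := by positivity
      field_simp
    refine (h₁.comp_tendsto (hx r)).congr (fun m => hLr r m) fun m => ?_
    simp
  have hcoeff : ∀ r, (((P r).coeff d : ℚ) : ℝ) = V := by
    intro r
    have h₁ := hV.comp (hx r)
    refine tendsto_nhds_unique ?_ h₁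
    have h₂ : (fun m : ℕ => (((P r - Polynomial.C ((P r).coeff d) * Polynomial.X ^ d).eval
        ((r.val + p * m + p : ℕ) : ℚ) : ℚ) : ℝ)) =o[atTop]
        fun m : ℕ => ((r.val + p * m + p : ℕ) : ℝ) ^ d := by
      set Q := P r - Polynomial.C ((P r).coeff d) * Polynomial.X ^ d with hQ
      by_cases hQ0 : Q = 0
      · rw [hQ0]
        simp
      have hlt : Q.natDegree < d := by
        have hle : Q.natDegree ≤ d := by
          refine (Polynomial.natDegree_sub_le _ _).trans (max_le (hdeg r) ?_)
          exact Polynomial.natDegree_C_mul_X_pow_le _ _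
        refine lt_of_le_of_ne hle fun heq => hQ0 ?_
        rw [← Polynomial.leadingCoeff_eq_zero, Polynomial.leadingCoeff, heq]
        simp [hQ]
      refine (isEquivalent_eval_rat Q (hx r)).isBigO.trans_isLittleO ?_
      refine IsLittleO.const_mul_left ?_ _
      exact (isLittleO_pow_pow_atTop_of_lt (𝕜 := ℝ) hlt).comp_tendsto
        (tendsto_natCast_atTop_atTop.comp (hx r))
    have h₃ := h₂.tendsto_div_nhds_zero.add_const (((P r).coeff d : ℚ) : ℝ)
    rw [zero_add] at h₃
    refine h₃.congr fun m => ?_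
    have hne : ((r.val + p * m + p : ℕ) : ℝ) ≠ 0 := by positivity
    simp only [Function.comp_apply]
    rw [hLr]
    simp only [Polynomial.eval_sub, Polynomial.eval_mul, Polynomial.eval_C, Polynomial.eval_pow,
      Polynomial.eval_X]
    push_cast at hne ⊢
    field_simp
    ring
  refine ⟨hdeg, (P 0).coeff d, hcoeff 0, fun r => ?_, ?_⟩
  · exact_mod_cast (hcoeff r).trans (hcoeff 0).symm
  rintro e rfl
  refine ⟨(P 0).coeff e, fun r => ZMod_const_of_second_difference hp (c := fun r => (P r).coeff e)
    (fun r => ?_) r⟩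
  have hvol : ∀ r, (P r).coeff (e + 1) = (P 0).coeff (e + 1) := fun r => by
    exact_mod_cast (hcoeff r).trans (hcoeff 0).symm
  -- `D` gives the second difference of `L` on the class of `r`. In its coefficient of degree `e = d
  -- - 1` the shifts contribute `(e + 1)(2 - 2 · 1)` times the common leading coefficient, that is,
  -- nothing.
  set D : ℚ[X] := (P (r + 2)).comp (Polynomial.X + Polynomial.C 2) -
    2 * (P (r + 1)).comp (Polynomial.X + Polynomial.C 1) + P r with hD
  have hD0 : D.coeff e = 0 := by
    refine coeff_eq_zero_of_isBigO (hx r) (e := ((e + 1 : ℕ) : ℤ) - 2) ?_ (by push_cast; omega)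
    refine (h2.comp_tendsto (hx r)).congr (fun m => ?_) fun m => by simp
    simp only [Function.comp_apply]
    rw [hLr, hL _ (by positivity), hL _ (by positivity)]
    have e1 : ((r.val + p * m + p + 2 : ℕ) : ZMod p) = r + 2 := by
      rw [Nat.cast_add, hcast]; simp
    have e2 : ((r.val + p * m + p + 1 : ℕ) : ZMod p) = r + 1 := by
      rw [Nat.cast_add, hcast]; simp
    rw [e1, e2, hD]
    simp
  have h2C : (2 : ℚ[X]) = Polynomial.C 2 := rfl
  rw [hD, Polynomial.coeff_add, Polynomial.coeff_sub, h2C, Polynomial.coeff_C_mul,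
    coeff_comp_X_add_C (hdeg _), coeff_comp_X_add_C (hdeg _), hvol (r + 2), hvol (r + 1)] at hD0
  linear_combination hD0

/-- For a monomial `a X^k` the denominator of `a` works, because `(n + D m) - n` divides `(n + D
m)^k - n^k`. -/
theorem exists_sub_eval_eq_intCast (P : ℚ[X]) :
    ∃ D : ℕ, 0 < D ∧ ∀ n m : ℤ, ∃ z : ℤ, P.eval ((n + D * m : ℤ) : ℚ) - P.eval (n : ℚ) = z := by
  induction P using Polynomial.induction_on' with
  | add P Q hP hQ =>
    obtain ⟨D, hD, h⟩ := hP
    obtain ⟨D', hD', h'⟩ := hQ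
    refine ⟨D * D', by positivity, fun n m => ?_⟩
    obtain ⟨z, hz⟩ := h n (D' * m)
    obtain ⟨z', hz'⟩ := h' n (D * m)
    refine ⟨z + z', ?_⟩
    push_cast at hz hz' ⊢
    rw [← hz, ← hz', Polynomial.eval_add, Polynomial.eval_add]
    ring_nf
  | monomial k a =>
    refine ⟨a.den, a.den_pos, fun n m => ?_⟩
    obtain ⟨y, hy⟩ := sub_dvd_pow_sub_pow (n + a.den * m) n k
    refine ⟨a.num * m * y, ?_⟩
    have hy' : ((n + a.den * m : ℤ) : ℚ) ^ k - (n : ℚ) ^ k = a.den * m * y := by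
      rw [add_sub_cancel_left] at hy
      exact_mod_cast hy
    rw [Polynomial.eval_monomial, Polynomial.eval_monomial, ← mul_sub, hy']
    push_cast
    conv_rhs => rw [← Rat.den_mul_eq_num a]
    ring

/-- A quasi-polynomial with integral values at the positive integers is integer-valued. -/
theorem exists_intCast_of_pos {p : ℕ} (hp : 0 < p) {P : ZMod p → ℚ[X]}
    (h : ∀ n : ℤ, 0 < n → ∃ z : ℤ, (P n).eval (n : ℚ) = z) (n : ℤ) :
    ∃ z : ℤ, (P n).eval (n : ℚ) = z := by
  obtain ⟨D, hD, hD'⟩ := exists_sub_eval_eq_intCast (P n)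
  obtain ⟨y, hy⟩ := hD' n (p * (n.natAbs + 1))
  -- A positive point in the class of `n` modulo `p`, reached by a multiple of `D`: the same
  -- polynomial applies there and its value differs from that at `n` by an integer.
  have hpos : 0 < n + D * (p * (n.natAbs + 1)) := by
    have : 1 * (n.natAbs + 1) ≤ D * p * (n.natAbs + 1) :=
      Nat.mul_le_mul_right _ (Nat.mul_pos hD hp)
    have h' : ((1 * (n.natAbs + 1) : ℕ) : ℤ) ≤ (D * p * (n.natAbs + 1) : ℕ) := by exact_mod_cast this
    push_cast at h' ⊢
    rw [mul_assoc] at h'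
    have := neg_abs_le n
    linarith
  obtain ⟨z, hz⟩ := h _ hpos
  have hcast : ((n + D * (p * (n.natAbs + 1)) : ℤ) : ZMod p) = n := by
    push_cast
    simp
  rw [hcast] at hz
  exact ⟨z - y, by rw [Int.cast_sub, ← hy, hz]; ring⟩

end PolynomialAsymptotics

/-! ### Replacing real data by rational data with the same signs -/

section RationalApproximation

/-- Finitely many positive real numbers can be mapped to positive rational numbers by a
`ℚ`-linear map fixing `1`. -/
theorem exists_linearMap_pos (s : Finset ℝ) :
    ∃ φ : ℝ →ₗ[ℚ] ℚ, φ 1 = 1 ∧ ∀ c ∈ s, 0 < c → 0 < φ c := by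
  classical
  let V : Submodule ℚ ℝ := Submodule.span ℚ (insert 1 s : Finset ℝ)
  let b := Module.finBasis ℚ V
  have hmem : ∀ c ∈ insert 1 s, c ∈ V := fun c hc => Submodule.subset_span hc
  let F : V → (Fin (Module.finrank ℚ V) → ℝ) → ℝ := fun v x => ∑ i, (b.repr v i : ℝ) * x i
  have hF : ∀ v : V, F v (fun i => (b i : ℝ)) = v := by
    intro v
    have h := congrArg (Subtype.val : V → ℝ) (b.sum_repr v)
    rw [← h]
    simp only [F, Submodule.coe_sum, Submodule.coe_smul, Rat.smul_def]
  -- With the values of the basis vectors treated as variables `x i`, positivity of the given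
  -- numbers is an open condition. It holds at the actual basis, hence at some rational point `q`.
  let U : Set (Fin (Module.finrank ℚ V) → ℝ) :=
    ⋂ c : (insert 1 s : Finset ℝ), {x | 0 < (c : ℝ) → 0 < F ⟨c, hmem c c.2⟩ x}
  have hU : IsOpen U := by
    refine isOpen_iInter_of_finite fun c => ?_
    by_cases hc : 0 < (c : ℝ)
    · simp only [hc, true_imp_iff]
      refine isOpen_lt continuous_const ?_
      exact continuous_finsetSum _ fun i _ => continuous_const.mul (continuous_apply i)
    · simp [hc]
  have hne : U.Nonempty := ⟨fun i => (b i : ℝ), Set.mem_iInter.2 fun c hc => by rwa [hF]⟩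
  obtain ⟨q, hq⟩ := (DenseRange.piMap (ι := Fin (Module.finrank ℚ V))
    fun _ => Rat.denseRange_cast (𝕜 := ℝ)).exists_mem_open hU hne
  obtain ⟨ψ, hψ⟩ := LinearMap.exists_extend (b.constr ℚ q)
  have hpos : ∀ c ∈ insert 1 s, 0 < c → 0 < ψ c := by
    intro c hc hc0
    have h₁ : 0 < F ⟨c, hmem c hc⟩ (Pi.map (fun _ => Rat.cast) q) :=
      Set.mem_iInter.1 hq ⟨c, hc⟩ hc0
    have h₂ : ψ c = ∑ i, b.repr ⟨c, hmem c hc⟩ i * q i := by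
      have := LinearMap.congr_fun hψ ⟨c, hmem c hc⟩
      simp only [LinearMap.comp_apply, Submodule.subtype_apply] at this
      rw [this, Module.Basis.constr_apply_fintype]
      simp [Module.Basis.equivFun_apply]
    rw [h₂]
    simp only [F, Pi.map_apply] at h₁
    exact_mod_cast h₁
  have h1 : 0 < ψ 1 := hpos 1 (Finset.mem_insert_self _ _) one_pos
  -- The number `1` was included among those kept positive precisely so that this rescaling
  -- preserves signs.
  refine ⟨(ψ 1)⁻¹ • ψ, by simp [h1.ne'], fun c hc hc0 => ?_⟩
  have := hpos c (Finset.mem_insert_of_mem hc) hc0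
  simp only [LinearMap.smul_apply, smul_eq_mul]
  positivity

theorem exists_common_denominator {ι : Type*} [Finite ι] (y : ι → ℚ) :
    ∃ k : ℕ, 0 < k ∧ ∃ z : ι → ℤ, ∀ i, (z i : ℚ) = k * y i := by
  have := Fintype.ofFinite ι
  classical
  refine ⟨∏ i, (y i).den, Finset.prod_pos fun i _ => (y i).den_pos,
    fun i => (∏ j ∈ Finset.univ.erase i, (y j).den : ℕ) * (y i).num, fun i => ?_⟩
  rw [← Finset.mul_prod_erase _ _ (Finset.mem_univ i)]
  push_cast
  rw [← Rat.den_mul_eq_num (y i)]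
  ring

variable {d : ℕ}

theorem form_add (a : Fin d → ℤ) (x y : Fin d → ℝ) : form a (x + y) = form a x + form a y := by
  simp [form, mul_add, Finset.sum_add_distrib]

theorem form_smul (a : Fin d → ℤ) (c : ℝ) (x : Fin d → ℝ) : form a (c • x) = c * form a x := by
  simp [form, Finset.mul_sum, mul_left_comm]

theorem form_neg (a : Fin d → ℤ) (x : Fin d → ℝ) : form a (-x) = -form a x := by
  simp [form]

theorem form_sub (a : Fin d → ℤ) (x y : Fin d → ℝ) : form a (x - y) = form a x - form a y := by
  rw [sub_eq_add_neg, form_add, form_neg, sub_eq_add_neg]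

@[simp] theorem scaledEmb_apply (n : ℕ+) (z : Fin d → ℤ) (j : Fin d) :
    scaledEmb d n z j = (z j : ℝ) / (n : ℕ) := rfl

theorem scaledEmb_one_apply (z : Fin d → ℤ) (j : Fin d) : scaledEmb d 1 z j = (z j : ℝ) := by
  simp

theorem form_scaledEmb (a : Fin d → ℤ) (n : ℕ+) (z : Fin d → ℤ) :
    form a (scaledEmb d n z) = (dotProduct a z : ℤ) / (n : ℕ) := by
  simp only [form, dotProduct, scaledEmb_apply]
  push_cast
  rw [Finset.sum_div]
  exact Finset.sum_congr rfl fun j _ => by ring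

theorem form_scaledEmb_one (a : Fin d → ℤ) (z : Fin d → ℤ) :
    form a (scaledEmb d 1 z) = (dotProduct a z : ℤ) := by
  simp [form_scaledEmb]

theorem scaledEmb_injective (n : ℕ+) : Function.Injective (scaledEmb d n) := by
  intro z z' h
  ext j
  have := congrFun h j
  have hn : ((n : ℕ) : ℝ) ≠ 0 := by exact_mod_cast n.ne_zero
  simpa [div_left_inj' hn] using this

theorem map_form (φ : ℝ →ₗ[ℚ] ℚ) (a : Fin d → ℤ) (x : Fin d → ℝ) :
    φ (form a x) = ∑ j, (a j : ℚ) * φ (x j) := by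
  simp only [form, map_sum]
  refine Finset.sum_congr rfl fun j _ => ?_
  rw [← zsmul_eq_mul, map_zsmul, zsmul_eq_mul]

/-- A real vector can be approximated by a rational one with respect to the signs of the values
of finitely many integral forms. -/
theorem exists_integral_vector {ι : Type*} [Finite ι] (a : ι → Fin d → ℤ) (x : Fin d → ℝ) :
    ∃ z : Fin d → ℤ, ∀ i, (form (a i) x = 0 → dotProduct (a i) z = 0) ∧
      (0 < form (a i) x → 0 < dotProduct (a i) z) := by
  classical
  have := Fintype.ofFinite ι
  obtain ⟨φ, -, hφ⟩ := exists_linearMap_pos (Finset.univ.image fun i => form (a i) x)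
  obtain ⟨k, hk, z, hz⟩ := exists_common_denominator fun j => φ (x j)
  have key : ∀ i, ((dotProduct (a i) z : ℤ) : ℚ) = k * φ (form (a i) x) := by
    intro i
    rw [map_form, Finset.mul_sum, dotProduct]
    push_cast
    exact Finset.sum_congr rfl fun j _ => by rw [hz]; ring
  refine ⟨z, fun i => ⟨fun h => ?_, fun h => ?_⟩⟩
  · have := key i
    rw [h, map_zero, mul_zero] at this
    exact_mod_cast this
  · have h₁ := hφ _ (Finset.mem_image_of_mem _ (Finset.mem_univ i)) h
    have : (0 : ℚ) < (dotProduct (a i) z : ℤ) := by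
      rw [key]
      positivity
    exact_mod_cast this

end RationalApproximation

/-! ### The monoid, its cone and the support forms -/

section Cone

variable {d s : ℕ} {M : AddSubmonoid (Fin d → ℤ)} {σ : Fin s → Fin d → ℤ}

/-- A `ℚ`-linear map fixing `1` turns a nonnegative real combination of elements of `M` into a
nonnegative rational one with the same integral value. Clearing denominators puts a multiple of `z`
in `M`, and normality concludes. -/
theorem IsPositiveNormalAffine.mem_of_mem_realCone (hM : IsPositiveNormalAffine M)
    {z : Fin d → ℤ} (hz : scaledEmb d 1 z ∈ realCone M) : z ∈ M := by
  classical
  obtain ⟨r, f, g, hfg⟩ := Submodule.mem_span_set'.1 hz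
  have hg : ∀ i, ∃ m ∈ M, scaledEmb d 1 m = (g i : Fin d → ℝ) := fun i => (g i).2
  choose m hmM hm using hg
  obtain ⟨φ, hφ1, hφ⟩ := exists_linearMap_pos (Finset.univ.image fun i => (f i : ℝ))
  have hφ0 : ∀ i, 0 ≤ φ (f i : ℝ) := by
    intro i
    rcases (f i).2.eq_or_lt with h | h
    · rw [← h, map_zero]
    · exact (hφ _ (Finset.mem_image_of_mem _ (Finset.mem_univ i)) h).le
  obtain ⟨k, hk, N, hN⟩ := exists_common_denominator fun i => φ (f i : ℝ)
  have hN0 : ∀ i, 0 ≤ N i := by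
    intro i
    have : (0 : ℚ) ≤ N i := by
      rw [hN]
      exact mul_nonneg (by positivity) (hφ0 i)
    exact_mod_cast this
  refine hM.normal z k hk ?_
  have hsum : k • z = ∑ i, (N i).toNat • m i := by
    ext j
    have h₁ : (z j : ℝ) = ∑ i, (f i : ℝ) * (m i j : ℝ) := by
      have := congrFun hfg j
      rw [scaledEmb_one_apply] at this
      rw [← this, Finset.sum_apply]
      refine Finset.sum_congr rfl fun i _ => ?_
      rw [← hm i, ← scaledEmb_one_apply]
      rfl
    have h₂ : (z j : ℚ) = ∑ i, (m i j : ℚ) * φ (f i : ℝ) := by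
      have h := congrArg φ h₁
      rw [map_sum, ← mul_one (z j : ℝ), ← zsmul_eq_mul, map_zsmul, hφ1, zsmul_eq_mul, mul_one] at h
      rw [h]
      refine Finset.sum_congr rfl fun i _ => ?_
      rw [mul_comm, ← zsmul_eq_mul, map_zsmul, zsmul_eq_mul]
    have h₃ : ((k * z j : ℤ) : ℚ) = ((∑ i, N i * m i j : ℤ) : ℚ) := by
      push_cast
      rw [h₂, Finset.mul_sum]
      exact Finset.sum_congr rfl fun i _ => by rw [hN]; ring
    have h₄ : (k : ℤ) * z j = ∑ i, N i * m i j := by exact_mod_cast h₃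
    simp only [Pi.smul_apply, Finset.sum_apply, nsmul_eq_mul, h₄]
    exact Finset.sum_congr rfl fun i _ => by
      simp [Int.toNat_of_nonneg (hN0 i)]
  rw [hsum]
  exact M.sum_mem fun i _ => M.nsmul_mem (hmM i) _

theorem IsSupportForms.mem_realCone (hσ : IsSupportForms M σ) {x : Fin d → ℝ} :
    x ∈ realCone M ↔ ∀ i, 0 ≤ form (σ i) x :=
  Set.ext_iff.1 hσ.cone_eq x

theorem scaledEmb_mem_realCone {m : Fin d → ℤ} (hm : m ∈ M) : scaledEmb d 1 m ∈ realCone M :=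
  PointedCone.subset_hull ⟨m, hm, rfl⟩

theorem IsSupportForms.mem_iff (hM : IsPositiveNormalAffine M) (hσ : IsSupportForms M σ)
    {z : Fin d → ℤ} : z ∈ M ↔ ∀ i, 0 ≤ dotProduct (σ i) z := by
  have : z ∈ M ↔ scaledEmb d 1 z ∈ realCone M :=
    ⟨scaledEmb_mem_realCone, hM.mem_of_mem_realCone⟩
  rw [this, hσ.mem_realCone]
  simp only [form_scaledEmb_one, Int.cast_nonneg_iff]

theorem IsSupportForms.scaledEmb_mem_realCone_iff (hM : IsPositiveNormalAffine M)
    (hσ : IsSupportForms M σ) {n : ℕ+} {z : Fin d → ℤ} :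
    scaledEmb d n z ∈ realCone M ↔ z ∈ M := by
  rw [hσ.mem_iff hM, hσ.mem_realCone]
  refine forall_congr' fun i => ?_
  have hn : (0 : ℝ) < (n : ℕ) := by exact_mod_cast n.pos
  rw [form_scaledEmb, le_div_iff₀ hn, zero_mul, Int.cast_nonneg_iff]

theorem IsSupportForms.exists_dotProduct_eq_one (hσ : IsSupportForms M σ) (i : Fin s) :
    ∃ w, dotProduct (σ i) w = 1 := by
  obtain ⟨g, hg⟩ := Finset.gcd_eq_sum_mul Finset.univ (σ i)
  exact ⟨g, by rw [dotProduct, ← hg, hσ.primitive i]⟩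

/-- A form vanishing on `M` vanishes on `gp(M) = ℤ^d`, whereas a primitive form takes the value `1`.
-/
theorem IsSupportForms.exists_mem_ne_zero (hM : IsPositiveNormalAffine M)
    (hσ : IsSupportForms M σ) (i : Fin s) : ∃ m ∈ M, dotProduct (σ i) m ≠ 0 := by
  by_contra! h
  let K : AddSubgroup (Fin d → ℤ) :=
    { carrier := {z | dotProduct (σ i) z = 0}
      zero_mem' := by simp
      add_mem' := fun {a b} ha hb => by
        simp only [Set.mem_ofPred_eq] at ha hb ⊢
        rw [dotProduct_add, ha, hb, add_zero]
      neg_mem' := fun {a} ha => by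
        simp only [Set.mem_ofPred_eq] at ha ⊢
        rw [dotProduct_neg, ha, neg_zero] }
  have hK : (⊤ : AddSubgroup (Fin d → ℤ)) ≤ K := by
    rw [← hM.gp_eq_top, AddSubgroup.closure_le]
    exact h
  obtain ⟨w, hw⟩ := hσ.exists_dotProduct_eq_one i
  have : dotProduct (σ i) w = 0 := hK (AddSubgroup.mem_top w)
  omega

theorem IsSupportForms.exists_mem_forall_pos (hM : IsPositiveNormalAffine M)
    (hσ : IsSupportForms M σ) : ∃ m ∈ M, ∀ i, 0 < dotProduct (σ i) m := by
  choose m hmM hm using hσ.exists_mem_ne_zero hM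
  refine ⟨∑ i, m i, M.sum_mem fun i _ => hmM i, fun i => ?_⟩
  rw [dotProduct_sum]
  exact Finset.sum_pos' (fun j _ => (hσ.mem_iff hM).1 (hmM j) i)
    ⟨i, Finset.mem_univ i, lt_of_le_of_ne ((hσ.mem_iff hM).1 (hmM i) i) (hm i).symm⟩

/-- Each facet of the cone contains a lattice point in its relative interior. -/
theorem IsSupportForms.exists_facet_point (hM : IsPositiveNormalAffine M)
    (hσ : IsSupportForms M σ) (i : Fin s) :
    ∃ w, dotProduct (σ i) w = 0 ∧ ∀ k, k ≠ i → 0 < dotProduct (σ k) w := by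
  obtain ⟨m, -, hm⟩ := hσ.exists_mem_forall_pos hM
  obtain ⟨x, hx, hxi⟩ : ∃ x : Fin d → ℝ, (∀ k, k ≠ i → 0 ≤ form (σ k) x) ∧ form (σ i) x < 0 := by
    by_contra! h
    refine hσ.irredundant i (Set.ext fun x => ⟨fun hx k _ => hσ.mem_realCone.1 hx k, fun hx => ?_⟩)
    refine hσ.mem_realCone.2 fun k => ?_
    by_cases hk : k = i
    · exact hk ▸ h x hx
    · exact hx k hk
  have hm' : ∀ k, 0 < form (σ k) (scaledEmb d 1 m) := fun k => by
    rw [form_scaledEmb_one]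
    exact_mod_cast hm k
  -- By irredundancy `x` violates only the `i`-th inequality. The positive combination with the
  -- interior point `m` is chosen to cancel `σ i`, and it stays positive for all other forms.
  obtain ⟨z, hz⟩ := exists_integral_vector σ
    (form (σ i) (scaledEmb d 1 m) • x + (-form (σ i) x) • scaledEmb d 1 m)
  refine ⟨z, (hz i).1 ?_, fun k hk => (hz k).2 ?_⟩
  · rw [form_add, form_smul, form_smul]
    ring
  · rw [form_add, form_smul, form_smul]
    have h₁ := mul_nonneg (hm' i).le (hx k hk)
    have h₂ := mul_pos (neg_pos.2 hxi) (hm' k)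
    linarith

theorem IsSupportForms.eq_zero_of_forall_dotProduct (hM : IsPositiveNormalAffine M)
    (hσ : IsSupportForms M σ) {z : Fin d → ℤ} (hz : ∀ i, dotProduct (σ i) z = 0) : z = 0 := by
  refine hM.positive z ((hσ.mem_iff hM).2 fun i => (hz i).ge) ((hσ.mem_iff hM).2 fun i => ?_)
  rw [dotProduct_neg, hz, neg_zero]

/-- A nonzero real common zero would give a nonzero integral one. To keep it nonzero, a signed
coordinate form is added to the forms whose signs are preserved. -/
theorem IsSupportForms.eq_zero_of_forall_form (hM : IsPositiveNormalAffine M)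
    (hσ : IsSupportForms M σ) {x : Fin d → ℝ} (hx : ∀ i, form (σ i) x = 0) : x = 0 := by
  by_contra hne
  obtain ⟨j, hj⟩ := Function.ne_iff.1 hne
  obtain ⟨c, hc, hcj⟩ : ∃ c : ℤ, c ≠ 0 ∧ 0 < c * x j := by
    rcases lt_or_gt_of_ne hj with h | h
    · exact ⟨-1, by simp, by simpa using h⟩
    · exact ⟨1, by simp, by simpa using h⟩
  obtain ⟨z, hz⟩ := exists_integral_vector
    (Sum.elim σ (fun _ : Unit => Pi.single j c)) x
  have h₁ : z = 0 := hσ.eq_zero_of_forall_dotProduct hM fun i => (hz (Sum.inl i)).1 (hx i)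
  have h₂ := (hz (Sum.inr ())).2 (by
    simp only [Sum.elim_inr, form]
    rw [Finset.sum_eq_single j]
    · simpa using hcj
    · intro k _ hk
      simp [hk]
    · simp)
  simp [h₁] at h₂

/-- The support forms bound the coordinates. -/
theorem IsSupportForms.exists_bound (hM : IsPositiveNormalAffine M) (hσ : IsSupportForms M σ) :
    ∃ C : ℕ, ∀ (R : ℝ) (x : Fin d → ℝ), 0 ≤ R → (∀ i, |form (σ i) x| ≤ R) →
      ∀ j, |x j| ≤ C * R := by
  let T : (Fin d → ℝ) →ₗ[ℝ] (Fin s → ℝ) :=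
    { toFun := fun x i => form (σ i) x
      map_add' := fun x y => funext fun i => form_add _ _ _
      map_smul' := fun c x => funext fun i => form_smul _ _ _ }
  obtain ⟨K, -, hK⟩ := T.exists_antilipschitzWith (LinearMap.ker_eq_bot'.2 fun x hx =>
    hσ.eq_zero_of_forall_form hM fun i => congrFun hx i)
  refine ⟨⌈(K : ℝ)⌉₊, fun R x hR hx j => ?_⟩
  have h₁ := hK.le_mul_dist x 0
  rw [map_zero, dist_zero_right, dist_zero_right] at h₁
  have h₂ : ‖T x‖ ≤ R := (pi_norm_le_iff_of_nonneg hR).2 fun i => hx i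
  calc |x j| = ‖x j‖ := rfl
    _ ≤ ‖x‖ := norm_le_pi_norm x j
    _ ≤ K * ‖T x‖ := h₁
    _ ≤ ⌈(K : ℝ)⌉₊ * R := by
      gcongr
      exact Nat.le_ceil _

/-- Two different support forms are linearly independent. -/
theorem IsSupportForms.exists_minor_ne_zero (hM : IsPositiveNormalAffine M)
    (hσ : IsSupportForms M σ) {i k : Fin s} (hik : i ≠ k) :
    ∃ j₁ j₂, σ i j₁ * σ k j₂ - σ i j₂ * σ k j₁ ≠ 0 := by
  by_contra! h
  obtain ⟨w, hw⟩ := hσ.exists_dotProduct_eq_one i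
  obtain ⟨y, hy, hy'⟩ := hσ.exists_facet_point hM i
  have hk := hy' k hik.symm
  -- If all minors vanish then `σ k` is a multiple of `σ i`, so it would vanish at the facet point
  -- `y`, where it is positive.
  have key : dotProduct (σ k) y = dotProduct (σ k) w * dotProduct (σ i) y := by
    have h₁ : dotProduct (σ i) w * dotProduct (σ k) y = dotProduct (σ k) w * dotProduct (σ i) y := by
      simp only [dotProduct, Finset.sum_mul_sum]
      refine Finset.sum_congr rfl fun a _ => Finset.sum_congr rfl fun b _ => ?_
      linear_combination w a * y b * h a b
    rw [← h₁, hw, one_mul]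
  rw [hy, mul_zero] at key
  omega

end Cone

/-! ### Counting lattice points in half-open cells -/

section CellCount

open Asymptotics Filter Topology MeasureTheory Pointwise

variable {d s : ℕ} {M : AddSubmonoid (Fin d → ℤ)} {σ : Fin s → Fin d → ℤ}

/-- The half-open polytope `u - 1 < σ x ≤ u`. -/
def halfOpenCell (σ : Fin s → Fin d → ℤ) (u : Fin s → ℤ) : Set (Fin d → ℝ) :=
  {x | ∀ i, (u i : ℝ) - 1 < form (σ i) x ∧ form (σ i) x ≤ u i}

theorem mem_halfOpenCell_iff_ceil {u : Fin s → ℤ} {x : Fin d → ℝ} :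
    x ∈ halfOpenCell σ u ↔ ∀ i, ⌈form (σ i) x⌉ = u i := by
  simp only [halfOpenCell, Set.mem_ofPred_eq, Int.ceil_eq_iff]

theorem cellCeil_eq_halfOpenCell {u : Fin s → ℤ} {γ : Set (Fin d → ℝ)} (hne : γ.Nonempty)
    (hγ : γ = {x | ∀ i, (u i : ℝ) - 1 < form (σ i) x ∧ form (σ i) x < u i}) :
    cellCeil σ γ = halfOpenCell σ u := by
  have key : ∀ y ∈ γ, ∀ i, ⌈form (σ i) y⌉ = u i := by
    intro y hy i
    rw [hγ] at hy
    exact Int.ceil_eq_iff.2 ⟨(hy i).1, (hy i).2.le⟩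
  ext x
  rw [mem_halfOpenCell_iff_ceil]
  constructor
  · rintro ⟨y, hy, h⟩ i
    rw [h, key y hy]
  · intro h
    obtain ⟨y, hy⟩ := hne
    exact ⟨y, hy, fun i => by rw [h, key y hy]⟩

/-- The forms `σ` and `-σ`. -/
def signedForms (σ : Fin s → Fin d → ℤ) : Fin s ⊕ Fin s → Fin d → ℤ :=
  Sum.elim σ (-σ)

/-- The bounds for `σ` and `-σ` on the lattice points of the dilates of a half-open cell are
`n • cellSlope u + cellOffset`. -/
def cellSlope (u : Fin s → ℤ) : Fin s ⊕ Fin s → ℤ :=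
  Sum.elim u (1 - u)

/-- The entry `-1` converts the strict lower bound: over the integers, `σ z > n (u - 1)` means `-σ z
≤ n (1 - u) - 1`. -/
def cellOffset (s : ℕ) : Fin s ⊕ Fin s → ℤ :=
  Sum.elim 0 (-1)

theorem mem_latticePoints_cell {u : Fin s → ℤ} {n : ℕ} {z : Fin d → ℤ} :
    z ∈ latticePoints (signedForms σ) (n • cellSlope u + cellOffset s) ↔
      ∀ i, n * (u i - 1) < dotProduct (σ i) z ∧ dotProduct (σ i) z ≤ n * u i := by
  have e₁ : ∀ i, (n • cellSlope u + cellOffset s) (Sum.inl i) = n * u i := fun i => by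
    simp [cellSlope, cellOffset]
  have e₂ : ∀ i, (n • cellSlope u + cellOffset s) (Sum.inr i) = -(n * (u i - 1)) - 1 := fun i => by
    simp [cellSlope, cellOffset]
    ring
  simp only [latticePoints, Set.mem_ofPred_eq, Sum.forall, e₁, e₂, ← forall_and]
  refine forall_congr' fun i => ?_
  simp only [signedForms, Sum.elim_inl, Sum.elim_inr, Pi.neg_apply, neg_dotProduct]
  constructor <;> rintro ⟨h₁, h₂⟩ <;> constructor <;> omega

theorem scaledEmb_mem_halfOpenCell {u : Fin s → ℤ} {n : ℕ+} {z : Fin d → ℤ} :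
    scaledEmb d n z ∈ halfOpenCell σ u ↔
      z ∈ latticePoints (signedForms σ) ((n : ℕ) • cellSlope u + cellOffset s) := by
  rw [mem_latticePoints_cell]
  refine forall_congr' fun i => ?_
  have hn : (0 : ℝ) < (n : ℕ) := by exact_mod_cast n.pos
  rw [form_scaledEmb, lt_div_iff₀ hn, div_le_iff₀ hn]
  have e₁ : (((n : ℕ) * (u i - 1) : ℤ) : ℝ) = (u i - 1) * (n : ℕ) := by push_cast; ring
  have e₂ : (((n : ℕ) * u i : ℤ) : ℝ) = u i * (n : ℕ) := by push_cast; ring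
  rw [← e₁, ← e₂, Int.cast_lt, Int.cast_le]

theorem halfOpenCell_inter_scaledLattice (u : Fin s → ℤ) (n : ℕ+) :
    halfOpenCell σ u ∩ scaledLattice d n =
      scaledEmb d n '' latticePoints (signedForms σ) ((n : ℕ) • cellSlope u + cellOffset s) := by
  ext x
  constructor
  · rintro ⟨hx, z, rfl⟩
    exact ⟨z, scaledEmb_mem_halfOpenCell.1 hx, rfl⟩
  · rintro ⟨z, hz, rfl⟩
    exact ⟨scaledEmb_mem_halfOpenCell.2 hz, z, rfl⟩

theorem ncard_halfOpenCell_inter (u : Fin s → ℤ) (n : ℕ+) :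
    (halfOpenCell σ u ∩ scaledLattice d n).ncard =
      (latticePoints (signedForms σ) ((n : ℕ) • cellSlope u + cellOffset s)).ncard := by
  rw [halfOpenCell_inter_scaledLattice, Set.ncard_image_of_injective _ (scaledEmb_injective n)]

theorem IsSupportForms.exists_integral_bound (hM : IsPositiveNormalAffine M)
    (hσ : IsSupportForms M σ) :
    ∃ C : ℕ, ∀ (R : ℕ) (z : Fin d → ℤ), (∀ l, dotProduct (signedForms σ l) z ≤ R) →
      ∀ j, |z j| ≤ C * R := by
  obtain ⟨C, hC⟩ := hσ.exists_bound hM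
  refine ⟨C, fun R z hz j => ?_⟩
  have := hC R (scaledEmb d 1 z) (Nat.cast_nonneg R) (fun i => ?_) j
  · rw [scaledEmb_one_apply] at this
    exact_mod_cast this
  · rw [form_scaledEmb_one]
    have h₁ := hz (Sum.inl i)
    have h₂ := hz (Sum.inr i)
    simp only [signedForms, Sum.elim_inl, Sum.elim_inr, Pi.neg_apply, neg_dotProduct] at h₁ h₂
    have : |dotProduct (σ i) z| ≤ (R : ℤ) := abs_le.2 ⟨by omega, h₁⟩
    exact_mod_cast this

theorem IsSupportForms.finite_latticePoints (hM : IsPositiveNormalAffine M)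
    (hσ : IsSupportForms M σ) (b : Fin s ⊕ Fin s → ℤ) :
    (latticePoints (signedForms σ) b).Finite := by
  obtain ⟨C, hC⟩ := hσ.exists_integral_bound hM
  exact ConicClasses.finite_latticePoints hC b

/-- The number of lattice points in the dilates of a half-open cell is a quasi-polynomial. -/
theorem IsSupportForms.exists_quasiPolynomial (hM : IsPositiveNormalAffine M)
    (hσ : IsSupportForms M σ) (u : Fin s → ℤ) :
    ∃ p : ℕ, 0 < p ∧ ∃ P : ZMod p → ℚ[X], ∀ n : ℕ, 0 < n →
      ((latticePoints (signedForms σ) (n • cellSlope u + cellOffset s)).ncard : ℚ) =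
        (P n).eval (n : ℚ) := by
  classical
  obtain ⟨C, hC⟩ := hσ.exists_bound hM
  -- On the `n`-th dilate all forms are bounded by `n U`, hence all coordinates by `C n U`.
  set U : ℕ := ∑ i, ((u i).natAbs + 1) with hU
  let upper : Fin s → (ℤ × (Fin d → ℤ) →+ ℤ) := fun i =>
    AddMonoidHom.mk' (fun x => x.1 * u i - dotProduct (σ i) x.2) fun x y => by
      simp only [Prod.fst_add, Prod.snd_add, dotProduct_add]
      ring
  let lower : Fin s → (ℤ × (Fin d → ℤ) →+ ℤ) := fun i =>
    AddMonoidHom.mk' (fun x => dotProduct (σ i) x.2 - x.1 * (u i - 1)) fun x y => by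
      simp only [Prod.fst_add, Prod.snd_add, dotProduct_add]
      ring
  have hmem : (∏ i, ((fun x => if 0 ≤ upper i x then (1 : ℚ) else 0) *
      (fun x => if 0 < lower i x then (1 : ℚ) else 0))) ∈ pqAlg (ℤ × (Fin d → ℤ)) :=
    (pqAlg _).prod_mem fun i _ => (pqAlg _).mul_mem (indicator_mem_pqAlg _)
      (strict_indicator_mem_pqAlg _)
  -- The summation box must contain the dilate; the `+ 1` makes the coordinate bound strict, since
  -- the intervals omit their left ends.
  have hsum := sum_piFinset_mem_pqAlg hmem (AddMonoidHom.mulLeft ((C * U + 1 : ℕ) : ℤ))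
  obtain ⟨g, hg, hgeq⟩ := exists_qpAlg_eq_of_pos hsum
  obtain ⟨p, hp, P, hP⟩ := exists_polynomial_of_mem_qpAlg hg
  refine ⟨p, hp, P, fun n hn => ?_⟩
  have hPn := hP n
  rw [← hgeq n (by exact_mod_cast hn)] at hPn
  push_cast at hPn
  rw [← hPn]
  have hset : latticePoints (signedForms σ) (n • cellSlope u + cellOffset s) =
      ((Fintype.piFinset fun _ : Fin d => Finset.Ioc (-(((C * U + 1 : ℕ) : ℤ) * n))
        (((C * U + 1 : ℕ) : ℤ) * n)).filter fun z => ∀ i, 0 ≤ upper i (n, z) ∧ 0 < lower i (n, z) :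
        Finset (Fin d → ℤ)) := by
    ext z
    have hiff : z ∈ latticePoints (signedForms σ) (n • cellSlope u + cellOffset s) ↔
        ∀ i, 0 ≤ upper i (n, z) ∧ 0 < lower i (n, z) := by
      rw [mem_latticePoints_cell]
      refine forall_congr' fun i => ?_
      simp only [upper, lower, AddMonoidHom.mk'_apply, sub_nonneg, sub_pos]
      exact and_comm
    simp only [Finset.coe_filter, Fintype.mem_piFinset, Set.mem_ofPred_eq, ← hiff]
    refine ⟨fun hz => ⟨fun j => ?_, hz⟩, fun hz => hz.2⟩
    have hbd := hC (n * U : ℕ) (scaledEmb d 1 z) (Nat.cast_nonneg _) (fun i => ?_) j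
    · rw [scaledEmb_one_apply] at hbd
      have hbd' : |z j| ≤ ((C * (n * U) : ℕ) : ℤ) := by exact_mod_cast hbd
      have hb : ((C * (n * U) : ℕ) : ℤ) < ((C * U + 1 : ℕ) : ℤ) * n := by
        push_cast
        nlinarith
      have := abs_le.1 hbd'
      rw [Finset.mem_Ioc]
      constructor <;> linarith
    · rw [form_scaledEmb_one]
      have h₁ := mem_latticePoints_cell.1 hz i
      have h₂ : (u i).natAbs + 1 ≤ U := Finset.single_le_sum
        (f := fun i => (u i).natAbs + 1) (fun _ _ => Nat.zero_le _) (Finset.mem_univ i)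
      have h₃ : ((u i).natAbs + 1 : ℤ) ≤ U := by exact_mod_cast h₂
      have h₄ : (n : ℤ) * (|u i| + 1) ≤ n * U := by
        rw [← Int.natCast_natAbs]
        gcongr
      have h₅ : (n : ℤ) * u i ≤ n * |u i| := by
        gcongr
        exact le_abs_self _
      have h₆ : (n : ℤ) * (-|u i|) ≤ n * u i := by
        gcongr
        exact neg_abs_le _
      have : |dotProduct (σ i) z| ≤ ((n * U : ℕ) : ℤ) := by
        push_cast
        refine abs_le.2 ⟨?_, ?_⟩ <;> nlinarith
      exact_mod_cast this
  rw [hset, Set.ncard_coe_finset, Finset.card_filter]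
  push_cast
  refine Finset.sum_congr (by simp) fun z _ => ?_
  rw [Finset.prod_apply]
  by_cases h : ∀ i, 0 ≤ upper i (n, z) ∧ 0 < lower i (n, z)
  · rw [if_pos h, Finset.prod_eq_one]
    intro i _
    rw [Pi.mul_apply, if_pos (h i).1, if_pos (h i).2, one_mul]
  · rw [if_neg h]
    push Not at h
    obtain ⟨i, hi⟩ := h
    symm
    refine Finset.prod_eq_zero (Finset.mem_univ i) ?_
    rw [Pi.mul_apply]
    by_cases h₁ : 0 ≤ upper i (n, z)
    · rw [if_neg (hi h₁).not_gt, mul_zero]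
    · rw [if_neg h₁, zero_mul]

/-- The second differences of the number of lattice points in the dilates of a half-open cell are
of order `n ^ (d - 2)`. -/
theorem IsSupportForms.isBigO_second_difference (hM : IsPositiveNormalAffine M)
    (hσ : IsSupportForms M σ) (u : Fin s → ℤ) :
    (fun n : ℕ =>
      ((latticePoints (signedForms σ) ((n + 2) • cellSlope u + cellOffset s)).ncard : ℝ) -
      2 * (latticePoints (signedForms σ) ((n + 1) • cellSlope u + cellOffset s)).ncard +
      (latticePoints (signedForms σ) (n • cellSlope u + cellOffset s)).ncard)
      =O[atTop] fun n : ℕ => (n : ℝ) ^ ((d : ℤ) - 2) := by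
  obtain ⟨C, hC⟩ := hσ.exists_integral_bound hM
  -- Opposite facets lie at distance `n u - n (u - 1) = n` in terms of `σ i`: adding the two
  -- equations forces `n + e + e' + 2 = 0`.
  have hopp : ∀ (i : Fin s) (e e' : ℤ), ∀ᶠ n : ℕ in atTop, ∀ z,
      ¬(dotProduct (σ i) z = n * u i + e + 1 ∧ dotProduct (-σ i) z = n * (1 - u i) + e' + 1) := by
    intro i e e'
    filter_upwards [eventually_gt_atTop (e + e' + 2).natAbs] with n hn z hz
    rw [neg_dotProduct] at hz
    have : (n : ℤ) + (e + e' + 2) = 0 := by linear_combination -hz.1 - hz.2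
    omega
  refine isBigO_second_difference_ncard hC ?_ _ _ ?_
  · rintro (i | i)
    · exact hσ.exists_dotProduct_eq_one i
    · obtain ⟨w, hw⟩ := hσ.exists_dotProduct_eq_one i
      exact ⟨-w, by simpa [signedForms] using hw⟩
  · rintro (i | i) (k | k) hik
    · obtain ⟨j₁, j₂, h⟩ := hσ.exists_minor_ne_zero hM (i := i) (k := k) (by simpa using hik)
      exact Or.inl ⟨j₁, j₂, h⟩
    · by_cases h : i = k
      · subst h
        exact Or.inr fun e => hopp i _ _
      · obtain ⟨j₁, j₂, h⟩ := hσ.exists_minor_ne_zero hM h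
        refine Or.inl ⟨j₁, j₂, fun h' => h ?_⟩
        simp only [signedForms, Sum.elim_inl, Sum.elim_inr, Pi.neg_apply] at h'
        linear_combination -h'
    · by_cases h : i = k
      · subst h
        refine Or.inr fun e => ?_
        filter_upwards [hopp i (e (Sum.inl i)) (e (Sum.inr i))] with n hn z hz
        exact hn z hz.symm
      · obtain ⟨j₁, j₂, h⟩ := hσ.exists_minor_ne_zero hM h
        refine Or.inl ⟨j₁, j₂, fun h' => h ?_⟩
        simp only [signedForms, Sum.elim_inl, Sum.elim_inr, Pi.neg_apply] at h'
        linear_combination -h'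
    · obtain ⟨j₁, j₂, h⟩ := hσ.exists_minor_ne_zero hM (i := i) (k := k) (by simpa using hik)
      refine Or.inl ⟨j₁, j₂, fun h' => h ?_⟩
      simp only [signedForms, Sum.elim_inr, Pi.neg_apply] at h'
      linear_combination h'

theorem continuous_form (a : Fin d → ℤ) : Continuous (form a) :=
  continuous_finsetSum _ fun j _ => continuous_const.mul (continuous_apply j)

theorem isLinearMap_form (a : Fin d → ℤ) : IsLinearMap ℝ (form a) :=
  ⟨form_add a, form_smul a⟩

theorem halfOpenCell_eq_iInter (u : Fin s → ℤ) :
    halfOpenCell σ u = ⋂ i, form (σ i) ⁻¹' Set.Ioc ((u i : ℝ) - 1) (u i) := by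
  ext x
  simp [halfOpenCell]

theorem convex_halfOpenCell (u : Fin s → ℤ) : Convex ℝ (halfOpenCell σ u) := by
  rw [halfOpenCell_eq_iInter]
  exact convex_iInter fun i => (convex_Ioc _ _).is_linear_preimage (isLinearMap_form _)

theorem measurableSet_halfOpenCell (u : Fin s → ℤ) : MeasurableSet (halfOpenCell σ u) := by
  rw [halfOpenCell_eq_iInter]
  exact MeasurableSet.iInter fun i => (continuous_form _).measurable measurableSet_Ioc

theorem IsSupportForms.isBounded_halfOpenCell (hM : IsPositiveNormalAffine M)
    (hσ : IsSupportForms M σ) (u : Fin s → ℤ) : Bornology.IsBounded (halfOpenCell σ u) := by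
  obtain ⟨C, hC⟩ := hσ.exists_bound hM
  set U : ℝ := ∑ i, (|(u i : ℝ)| + 1) with hU
  have hU0 : 0 ≤ U := Finset.sum_nonneg fun i _ => by positivity
  refine (Metric.isBounded_closedBall (x := (0 : Fin d → ℝ)) (r := C * U)).subset fun x hx => ?_
  rw [mem_closedBall_zero_iff, pi_norm_le_iff_of_nonneg (by positivity)]
  refine fun j => hC U x hU0 (fun i => ?_) j
  have h₁ := hx i
  have h₂ : |(u i : ℝ)| + 1 ≤ U := Finset.single_le_sum
    (f := fun i => |(u i : ℝ)| + 1) (fun _ _ => by positivity) (Finset.mem_univ i)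
  have h₃ := le_abs_self (u i : ℝ)
  have h₄ := neg_abs_le (u i : ℝ)
  exact abs_le.2 ⟨by linarith, by linarith⟩

theorem mem_span_basisFun_iff {x : Fin d → ℝ} :
    x ∈ Submodule.span ℤ (Set.range (Pi.basisFun ℝ (Fin d))) ↔ ∃ z : Fin d → ℤ,
      x = fun j => (z j : ℝ) := by
  rw [Module.Basis.mem_span_iff_repr_mem]
  simp only [Pi.basisFun_repr, Set.mem_range, algebraMap_int_eq, eq_intCast]
  constructor
  · intro h
    choose z hz using h
    exact ⟨z, funext fun j => (hz j).symm⟩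
  · rintro ⟨z, rfl⟩ j
    exact ⟨z j, rfl⟩

/-- The cell is bounded and convex, so its frontier is a null set and counting points of `(1/n)ℤ^d`
is a convergent Riemann sum. -/
theorem IsSupportForms.tendsto_ncard_div (hM : IsPositiveNormalAffine M)
    (hσ : IsSupportForms M σ) (u : Fin s → ℤ) :
    Tendsto (fun n : ℕ =>
      ((latticePoints (signedForms σ) (n • cellSlope u + cellOffset s)).ncard : ℝ) / (n : ℝ) ^ d)
      atTop (𝓝 (volume.real (halfOpenCell σ u))) := by
  have h := tendsto_card_div_pow_atTop_volume (halfOpenCell σ u) (hσ.isBounded_halfOpenCell hM u)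
    (measurableSet_halfOpenCell u) ((convex_halfOpenCell u).addHaar_frontier volume)
  refine h.congr' ?_
  filter_upwards [eventually_gt_atTop 0] with n hn
  obtain ⟨n, rfl⟩ : ∃ m : ℕ+, (m : ℕ) = n := ⟨⟨n, hn⟩, rfl⟩
  have hset : halfOpenCell σ u ∩
      ((n : ℕ) : ℝ)⁻¹ • (Submodule.span ℤ (Set.range (Pi.basisFun ℝ (Fin d))) : Set (Fin d → ℝ)) =
      halfOpenCell σ u ∩ scaledLattice d n := by
    congr 1
    ext x
    simp only [Set.mem_smul_set, SetLike.mem_coe, mem_span_basisFun_iff]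
    constructor
    · rintro ⟨_, ⟨z, rfl⟩, rfl⟩
      refine ⟨z, funext fun j => ?_⟩
      simp [div_eq_inv_mul]
    · rintro ⟨z, rfl⟩
      refine ⟨_, ⟨z, rfl⟩, funext fun j => ?_⟩
      simp [div_eq_inv_mul]
  rw [hset, Fintype.card_fin, Nat.card_coe_set_eq, ncard_halfOpenCell_inter]

/-- An open cell and its upper closure have the same volume. -/
theorem volume_openCell_eq {u : Fin s → ℤ} {γ : Set (Fin d → ℝ)} (hne : γ.Nonempty)
    (hγ : γ = {x | ∀ i, (u i : ℝ) - 1 < form (σ i) x ∧ form (σ i) x < u i}) :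
    volume γ = volume (halfOpenCell σ u) := by
  have hconv : Convex ℝ γ := by
    have : γ = ⋂ i, form (σ i) ⁻¹' Set.Ioo ((u i : ℝ) - 1) (u i) := by
      rw [hγ]
      ext x
      simp
    rw [this]
    exact convex_iInter fun i => (convex_Ioo _ _).is_linear_preimage (isLinearMap_form _)
  have hsub : γ ⊆ halfOpenCell σ u := by
    rw [hγ]
    exact fun x hx i => ⟨(hx i).1, (hx i).2.le⟩
  have hsub' : halfOpenCell σ u ⊆ closure γ := by
    intro x hx
    obtain ⟨y, hy⟩ := hne
    have hy' : ∀ i, (u i : ℝ) - 1 < form (σ i) y ∧ form (σ i) y < u i := by rwa [hγ] at hy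
    -- Moving from `x` slightly towards a point of the open cell makes all inequalities strict.
    refine mem_closure_of_tendsto (b := 𝓝[>] (0 : ℝ)) (f := fun t : ℝ => x + t • (y - x)) ?_ ?_
    · have : Tendsto (fun t : ℝ => x + t • (y - x)) (𝓝 0) (𝓝 (x + (0 : ℝ) • (y - x))) :=
        Continuous.tendsto (by fun_prop) 0
      rw [zero_smul, add_zero] at this
      exact this.mono_left nhdsWithin_le_nhds
    · filter_upwards [Ioo_mem_nhdsGT (zero_lt_one' ℝ)] with t ht
      rw [hγ]
      intro i
      rw [form_add, form_smul, form_sub]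
      have h₁ := hx i
      have h₂ := hy' i
      have ht' : 0 < 1 - t := by linarith [ht.2]
      constructor
      · nlinarith [mul_lt_mul_of_pos_left h₂.1 ht.1, mul_lt_mul_of_pos_left h₁.1 ht']
      · nlinarith [mul_lt_mul_of_pos_left h₂.2 ht.1, mul_le_mul_of_nonneg_left h₁.2 ht'.le]
  refine le_antisymm (measure_mono hsub) ((measure_mono hsub').trans ?_)
  rw [closure_eq_self_union_frontier]
  refine (measure_union_le _ _).trans ?_
  rw [hconv.addHaar_frontier volume, add_zero]

/-- The lattice point counting function of a half-open cell. -/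
theorem IsSupportForms.exists_counting_quasiPolynomial (hM : IsPositiveNormalAffine M)
    (hσ : IsSupportForms M σ) (u : Fin s → ℤ) :
    ∃ q : ℤ → ℤ, IsQuasiPolynomial (fun n => (q n : ℚ)) d ∧
      (∀ n : ℕ+, ((halfOpenCell σ u ∩ scaledLattice d n).ncard : ℤ) = q (n : ℕ)) ∧
      ∃ (vol a : ℚ) (q' : ℤ → ℚ),
        volume (halfOpenCell σ u) = ENNReal.ofReal (vol : ℝ) ∧
        IsQuasiPolynomial q' ((d : ℤ) - 2) ∧
        ∀ n : ℤ, (q n : ℚ) = vol * (n : ℚ) ^ d + a * (n : ℚ) ^ ((d : ℤ) - 1) + q' n := by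
  obtain ⟨p, hp, P, hP⟩ := hσ.exists_quasiPolynomial hM u
  obtain ⟨hdeg, vol, hvol, hPvol, hPa⟩ := exists_constant_coefficients hp (P := P)
    (L := fun n =>
      ((latticePoints (signedForms σ) (n • cellSlope u + cellOffset s)).ncard : ℝ))
    (fun n hn => by rw [← hP n hn]; simp) (hσ.tendsto_ncard_div hM u)
    (hσ.isBigO_second_difference hM u)
  have hint : ∀ n : ℤ, ∃ z : ℤ, (P n).eval (n : ℚ) = z := exists_intCast_of_pos hp fun n hn => by
    lift n to ℕ using hn.le
    have := hP n (by exact_mod_cast hn)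
    exact ⟨(latticePoints (signedForms σ) (n • cellSlope u + cellOffset s)).ncard, by
      rw [Int.cast_natCast, Int.cast_natCast, Int.cast_natCast, this]⟩
  choose q hq using hint
  refine ⟨q, ⟨p, hp, P, fun r k hk => ?_, fun n => (hq n).symm⟩, fun n => ?_, vol, ?_⟩
  · exact Polynomial.coeff_eq_zero_of_natDegree_lt ((hdeg r).trans_lt (by exact_mod_cast hk))
  · have h₁ := hP n n.pos
    have h₂ := hq (n : ℕ)
    rw [ncard_halfOpenCell_inter]
    rw [Int.cast_natCast, Int.cast_natCast, ← h₁] at h₂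
    exact_mod_cast h₂
  have hvolume : volume (halfOpenCell σ u) = ENNReal.ofReal (vol : ℝ) := by
    rw [hvol, ofReal_measureReal (hσ.isBounded_halfOpenCell hM u).measure_lt_top.ne]
  cases d with
  | zero =>
    -- For `d = 0` every `P n` is the constant `vol`; taking `a = 0` removes the term with exponent
    -- `-1`.
    refine ⟨0, 0, hvolume, ⟨1, one_pos, 0, by simp, by simp⟩, fun n => ?_⟩
    rw [← hq n, Polynomial.eq_C_of_natDegree_eq_zero (Nat.le_zero.1 (hdeg n)), hPvol]
    simp
  | succ e =>
    obtain ⟨a, ha⟩ := hPa e rfl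
    refine ⟨a, fun n => (P n - Polynomial.C vol * Polynomial.X ^ (e + 1) -
      Polynomial.C a * Polynomial.X ^ e).eval (n : ℚ), hvolume,
      ⟨p, hp, fun r => P r - Polynomial.C vol * Polynomial.X ^ (e + 1) -
        Polynomial.C a * Polynomial.X ^ e, fun r k hk => ?_, fun n => rfl⟩, fun n => ?_⟩
    · simp only [Polynomial.coeff_sub, Polynomial.coeff_C_mul, Polynomial.coeff_X_pow]
      rcases lt_trichotomy k (e + 1) with h | rfl | h
      · obtain rfl : k = e := by
          push_cast at hk
          omega
        simp [ha]
      · simp [hPvol]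
      · rw [Polynomial.coeff_eq_zero_of_natDegree_lt ((hdeg r).trans_lt h), if_neg (by omega),
          if_neg (by omega)]
        simp
    · rw [← hq n, show ((e + 1 : ℕ) : ℤ) - 1 = e by push_cast; ring, zpow_natCast]
      simp only [Polynomial.eval_sub, Polynomial.eval_mul, Polynomial.eval_C, Polynomial.eval_pow,
        Polynomial.eval_X]
      ring

end CellCount

/-! ### Isomorphisms of monomial modules -/

section MonomialModules

open AddMonoidAlgebra

variable {K : Type*} [Field K]

/-- Units of the group algebra of a group with unique sums are monomials. -/
theorem exists_eq_single_of_mul_eq_one {G : Type*} [AddCommGroup G] [TwoUniqueSums G]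
    {f g : AddMonoidAlgebra K G} (h : f * g = 1) : ∃ a c, c ≠ 0 ∧ f = single a c := by
  classical
  have hf : f.coeff.support.card ≠ 0 := by
    rw [Ne, Finset.card_eq_zero, Finsupp.support_eq_empty, coeff_eq_zero]
    rintro rfl
    simp at h
  have hg : g.coeff.support.card ≠ 0 := by
    rw [Ne, Finset.card_eq_zero, Finsupp.support_eq_empty, coeff_eq_zero]
    rintro rfl
    simp at h
  -- Otherwise two distinct pairs of exponents have unique sums. Each gives a nonzero coefficient of
  -- `f * g = 1`, so both sums are `0`, contradicting uniqueness.
  have hle : f.coeff.support.card * g.coeff.support.card ≤ 1 := by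
    by_contra! hlt
    obtain ⟨p₁, h₁, p₂, h₂, hne, hu₁, hu₂⟩ := TwoUniqueSums.uniqueAdd_of_one_lt_card hlt
    rw [Finset.mem_product] at h₁ h₂
    have key : ∀ p : G × G, p.1 ∈ f.coeff.support ∧ p.2 ∈ g.coeff.support →
        UniqueAdd f.coeff.support g.coeff.support p.1 p.2 → p.1 + p.2 = 0 := by
      intro p hp hu
      by_contra h0
      have := coeff_mul_add_of_uniqueAdd hu
      rw [h, one_def, coeff_single, Finsupp.single_eq_of_ne h0] at this
      exact mul_ne_zero (Finsupp.mem_support_iff.1 hp.1) (Finsupp.mem_support_iff.1 hp.2) this.symm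
    have e := hu₂ h₁.1 h₁.2 ((key p₁ h₁ hu₁).trans (key p₂ h₂ hu₂).symm)
    exact hne (Prod.ext e.1 e.2)
  have hcard : f.coeff.support.card = 1 := by nlinarith [Nat.pos_of_ne_zero hf, Nat.pos_of_ne_zero hg]
  obtain ⟨a, hc, hfa⟩ := Finsupp.card_support_eq_one.1 hcard
  exact ⟨a, f.coeff a, hc, coeff_injective (by rw [hfa]; simp)⟩

variable {d : ℕ} {N : AddSubmonoid (Fin d → ℝ)}

theorem single_mem_monomialModule {S : Set (Fin d → ℝ)} {hS : ∀ m ∈ N, ∀ x ∈ S, m + x ∈ S}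
    {x : Fin d → ℝ} (hx : x ∈ S) (c : K) : single x c ∈ monomialModule K N S hS := by
  intro y hy
  have := Finsupp.support_single_subset hy
  rw [Finset.mem_singleton] at this
  exact this ▸ hx

theorem mem_of_single_mem_monomialModule {S : Set (Fin d → ℝ)}
    {hS : ∀ m ∈ N, ∀ x ∈ S, m + x ∈ S} {x : Fin d → ℝ} {c : K} (hc : c ≠ 0)
    (h : single x c ∈ monomialModule K N S hS) : x ∈ S :=
  h x (by simp [hc])

theorem single_mem_monoidAlg {x : Fin d → ℝ} (hx : x ∈ N) (c : K) :
    single x c ∈ monoidAlg K N := by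
  intro y hy
  have := Finsupp.support_single_subset hy
  rw [Finset.mem_singleton] at this
  exact this ▸ hx

/-- Homomorphisms between monomial modules of rank one are multiplications by an element of the
group algebra. -/
theorem exists_mul_of_linearMap {S T : Set (Fin d → ℝ)} {hS : ∀ m ∈ N, ∀ x ∈ S, m + x ∈ S}
    {hT : ∀ m ∈ N, ∀ x ∈ T, m + x ∈ T} (hSc : ∀ x ∈ S, ∀ y ∈ S, ∃ m ∈ N, ∃ m' ∈ N, m + x = m' + y)
    (hSne : S.Nonempty) (e : monomialModule K N S hS →ₗ[monoidAlg K N] monomialModule K N T hT) :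
    ∃ f : AddMonoidAlgebra K (Fin d → ℝ), ∀ h, (e h : AddMonoidAlgebra K (Fin d → ℝ)) = h * f := by
  obtain ⟨x₀, hx₀⟩ := hSne
  let E : ∀ x, x ∈ S → AddMonoidAlgebra K (Fin d → ℝ) := fun x hx =>
    e ⟨single x 1, single_mem_monomialModule hx 1⟩
  have hsmul : ∀ m (hm : m ∈ N) (c : K) x (hx : x ∈ S) (y) (hy : y ∈ S), m + x = y →
      (e ⟨single y c, single_mem_monomialModule hy c⟩ : AddMonoidAlgebra K (Fin d → ℝ)) =
        single m c * E x hx := by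
    rintro m hm c x hx _ hy rfl
    have := e.map_smul ⟨single m c, single_mem_monoidAlg hm c⟩
      ⟨single x 1, single_mem_monomialModule hx 1⟩
    have h := congrArg Subtype.val this
    have hl : (⟨single m c, single_mem_monoidAlg hm c⟩ : monoidAlg K N) •
        (⟨single x 1, single_mem_monomialModule hx 1⟩ : monomialModule K N S hS) =
        ⟨single (m + x) c, single_mem_monomialModule hy c⟩ := by
      refine Subtype.ext ?_
      change single m c * single x 1 = _
      rw [single_mul_single, mul_one]
    rw [hl] at h
    exact h
  -- Linearity at the common multiple `m + x = m' + x₀` relates the two values; the monomial of `m`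
  -- can be cancelled in the group algebra. So the multiplier is `single (-x₀) 1` times the value at
  -- `x₀`.
  have hE : ∀ x (hx : x ∈ S), E x hx = single x 1 * (single (-x₀) 1 * E x₀ hx₀) := by
    intro x hx
    obtain ⟨m, hm, m', hm', h⟩ := hSc x hx x₀ hx₀
    have h₁ := hsmul m hm 1 x hx _ (hS m hm x hx) rfl
    have h₂ := hsmul m' hm' 1 x₀ hx₀ _ (hS m hm x hx) h.symm
    have h₃ : single (-m) (1 : K) * (single m 1 * E x hx) =
        single (-m) 1 * (single m' 1 * E x₀ hx₀) := by rw [← h₁, h₂]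
    rw [← mul_assoc, ← mul_assoc, single_mul_single, single_mul_single, neg_add_cancel, mul_one,
      ← one_def, one_mul] at h₃
    rw [h₃, ← mul_assoc, single_mul_single, mul_one]
    congr 2
    rw [neg_add_eq_sub, ← sub_eq_add_neg, sub_eq_sub_iff_add_eq_add, ← h, add_comm]
  refine ⟨single (-x₀) 1 * E x₀ hx₀, ?_⟩
  have hspan : ∀ (s : Finset (Fin d → ℝ)) (c : (Fin d → ℝ) → K) (hs : ∀ x ∈ s, x ∈ S)
      (hmem : ∑ x ∈ s, single x (c x) ∈ monomialModule K N S hS),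
      (e ⟨∑ x ∈ s, single x (c x), hmem⟩ : AddMonoidAlgebra K (Fin d → ℝ)) =
        (∑ x ∈ s, single x (c x)) * (single (-x₀) 1 * E x₀ hx₀) := by
    classical
    intro s c
    induction s using Finset.induction_on with
    | empty =>
      intro _ hmem
      have : (⟨∑ x ∈ (∅ : Finset (Fin d → ℝ)), single x (c x), hmem⟩ :
          monomialModule K N S hS) = 0 := Subtype.ext (by simp)
      rw [this, map_zero, Finset.sum_empty, zero_mul]
      rfl
    | insert a s ha ih =>
      intro hs hmem
      have haS := hs a (Finset.mem_insert_self a s)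
      have hs' : ∀ x ∈ s, x ∈ S := fun x hx => hs x (Finset.mem_insert_of_mem hx)
      have hmem' : ∑ x ∈ s, single x (c x) ∈ monomialModule K N S hS :=
        Submodule.sum_mem _ fun x hx => single_mem_monomialModule (hs' x hx) _
      have : (⟨∑ x ∈ insert a s, single x (c x), hmem⟩ : monomialModule K N S hS) =
          ⟨single a (c a), single_mem_monomialModule haS _⟩ + ⟨_, hmem'⟩ :=
        Subtype.ext (Finset.sum_insert ha)
      rw [this, map_add, Submodule.coe_add, ih hs' hmem', Finset.sum_insert ha, add_mul,
        hsmul 0 N.zero_mem (c a) a haS a haS (zero_add a), hE a haS, ← mul_assoc,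
        single_mul_single, zero_add, mul_one]
  rintro ⟨h, hh⟩
  have hsum : h = ∑ x ∈ h.coeff.support, single x (h.coeff x) := (sum_coeff_single h).symm
  have := hspan h.coeff.support h.coeff hh (hsum ▸ hh)
  simp only [← hsum] at this
  exact this

/-- Two monomial modules of rank one are isomorphic if and only if they differ by a translation. -/
theorem nonempty_linearEquiv_iff {S T : Set (Fin d → ℝ)} {hS : ∀ m ∈ N, ∀ x ∈ S, m + x ∈ S}
    {hT : ∀ m ∈ N, ∀ x ∈ T, m + x ∈ T} (hSc : ∀ x ∈ S, ∀ y ∈ S, ∃ m ∈ N, ∃ m' ∈ N, m + x = m' + y)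
    (hTc : ∀ x ∈ T, ∀ y ∈ T, ∃ m ∈ N, ∃ m' ∈ N, m + x = m' + y)
    (hSne : S.Nonempty) (hTne : T.Nonempty) :
    Nonempty (monomialModule K N S hS ≃ₗ[monoidAlg K N] monomialModule K N T hT) ↔
      ∃ a, ∀ x, x ∈ S ↔ a + x ∈ T := by
  constructor
  · rintro ⟨e⟩
    obtain ⟨f, hf⟩ := exists_mul_of_linearMap hSc hSne e.toLinearMap
    obtain ⟨g, hg⟩ := exists_mul_of_linearMap hTc hTne e.symm.toLinearMap
    obtain ⟨x₀, hx₀⟩ := hSne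
    -- Applying the map and its inverse to one monomial multiplies that monomial by `f * g`, and
    -- monomials are invertible.
    have hfg : f * g = 1 := by
      have h₁ := hg (e ⟨single x₀ 1, single_mem_monomialModule hx₀ 1⟩)
      have h₂ := hf ⟨single x₀ 1, single_mem_monomialModule hx₀ 1⟩
      simp only [LinearEquiv.coe_coe, LinearEquiv.symm_apply_apply] at h₁ h₂
      rw [h₂] at h₁
      have h₃ := congrArg (single (-x₀) (1 : K) * ·) h₁
      simp only [← mul_assoc, single_mul_single, neg_add_cancel, mul_one] at h₃
      rw [← one_def, one_mul] at h₃
      exact h₃.symm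
    obtain ⟨a, c, hc, rfl⟩ := exists_eq_single_of_mul_eq_one hfg
    have hg' : g = single (-a) c⁻¹ := by
      have h₃ := congrArg (single (-a) c⁻¹ * ·) hfg
      simp only [← mul_assoc, single_mul_single, neg_add_cancel, inv_mul_cancel₀ hc, mul_one] at h₃
      rwa [← one_def, one_mul] at h₃
    refine ⟨a, fun x => ⟨fun hx => ?_, fun hx => ?_⟩⟩
    · have h := hf ⟨single x 1, single_mem_monomialModule hx 1⟩
      rw [single_mul_single, one_mul, add_comm] at h
      exact mem_of_single_mem_monomialModule hc (h ▸ Subtype.prop _)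
    · have h := hg ⟨single (a + x) 1, single_mem_monomialModule hx 1⟩
      rw [hg', single_mul_single, one_mul, add_neg_cancel_comm] at h
      exact mem_of_single_mem_monomialModule (inv_ne_zero hc) (h ▸ Subtype.prop _)
  · rintro ⟨a, ha⟩
    have hcoeff : ∀ (b : Fin d → ℝ) (f : AddMonoidAlgebra K (Fin d → ℝ)) (x : Fin d → ℝ),
        (single b (1 : K) * f).coeff x = f.coeff (-b + x) := fun b f x => by
      rw [coeff_single_mul_apply, one_mul]
    refine ⟨LinearEquiv.ofLinearMap
      (LinearMap.restrict (LinearMap.mulLeft (monoidAlg K N) (single a (1 : K))) ?_)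
      (LinearMap.restrict (LinearMap.mulLeft (monoidAlg K N) (single (-a) (1 : K))) ?_) ?_ ?_⟩
    · intro f hf x hx
      rw [LinearMap.mulLeft_apply, Finsupp.mem_support_iff, hcoeff] at hx
      have := (ha _).1 (hf _ (Finsupp.mem_support_iff.2 hx))
      rwa [add_neg_cancel_left] at this
    · intro f hf x hx
      rw [LinearMap.mulLeft_apply, Finsupp.mem_support_iff, hcoeff, neg_neg] at hx
      exact (ha x).2 (hf _ (Finsupp.mem_support_iff.2 hx))
    · refine LinearMap.ext fun f => Subtype.ext ?_
      change single a (1 : K) * (single (-a) 1 * (f : AddMonoidAlgebra K (Fin d → ℝ))) =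
        (f : AddMonoidAlgebra K (Fin d → ℝ))
      rw [← mul_assoc, single_mul_single, add_neg_cancel, mul_one, ← one_def, one_mul]
    · refine LinearMap.ext fun f => Subtype.ext ?_
      change single (-a) (1 : K) * (single a 1 * (f : AddMonoidAlgebra K (Fin d → ℝ))) =
        (f : AddMonoidAlgebra K (Fin d → ℝ))
      rw [← mul_assoc, single_mul_single, neg_add_cancel, mul_one, ← one_def, one_mul]

end MonomialModules

/-! ### The decomposition by residue classes -/

section Decomposition

open AddMonoidAlgebra

variable {K : Type*} [Field K] {d : ℕ} {M : AddSubmonoid (Fin d → ℤ)}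

theorem scaledEmb_one_eq (n : ℕ+) (z : Fin d → ℤ) :
    scaledEmb d 1 z = scaledEmb d n ((n : ℕ) • z) := by
  ext j
  simp

theorem scaledEmb_one_mem_scaledLattice (n : ℕ+) (z : Fin d → ℤ) :
    scaledEmb d 1 z ∈ scaledLattice d n :=
  scaledEmb_one_eq n z ▸ ⟨_, rfl⟩

theorem residueClass_eq_iff {n : ℕ+} {x y : Fin d → ℝ} (hx : x ∈ scaledLattice d n)
    (hy : y ∈ scaledLattice d n) :
    ((QuotientAddGroup.mk ⟨x, hx⟩ : ResidueClass d n) = QuotientAddGroup.mk ⟨y, hy⟩) ↔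
      ∃ z : Fin d → ℤ, y = x + scaledEmb d 1 z := by
  rw [QuotientAddGroup.eq, AddSubgroup.mem_addSubgroupOf]
  change -x + y ∈ scaledLattice d 1 ↔ _
  constructor
  · rintro ⟨z, hz⟩
    exact ⟨z, by rw [hz]; abel⟩
  · rintro ⟨z, rfl⟩
    exact ⟨z, by abel⟩

/-- The other summands all lie in the monomial module on exponents outside the class `c`, which
shares no monomial with the summand of `c`. -/
theorem iSupIndep_summand (n : ℕ+) : iSupIndep (summand K M n) := by
  intro c
  have hS : ∀ m ∈ scaledMonoid M 1, ∀ x ∈ {x | ∀ h : x ∈ scaledLattice d n,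
      (QuotientAddGroup.mk ⟨x, h⟩ : ResidueClass d n) ≠ c},
      m + x ∈ {x | ∀ h : x ∈ scaledLattice d n,
        (QuotientAddGroup.mk ⟨x, h⟩ : ResidueClass d n) ≠ c} := by
    rintro _ ⟨z, -, rfl⟩ x hx h
    have hx' : x ∈ scaledLattice d n := by
      simpa using (scaledLattice d n).add_mem
        ((scaledLattice d n).neg_mem (scaledEmb_one_mem_scaledLattice n z)) h
    rw [← (residueClass_eq_iff hx' h).2 ⟨z, add_comm _ _⟩]
    exact hx hx'
  have hle : ⨆ j, ⨆ (_ : j ≠ c), summand K M n j ≤ monomialModule K (scaledMonoid M 1) _ hS := by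
    refine iSup₂_le fun j hj f hf x hx h => ?_
    obtain ⟨-, h', hc⟩ := hf x hx
    exact fun hc' => hj (hc.symm.trans hc')
  refine Disjoint.mono_right hle (Submodule.disjoint_def.2 fun f hf hf' => ?_)
  rw [← coeff_eq_zero, ← Finsupp.support_eq_empty, Finset.eq_empty_iff_forall_notMem]
  intro x hx
  obtain ⟨-, h, hc⟩ := hf x hx
  exact hf' x hx h hc

theorem coe_iSup_summand (n : ℕ+) :
    ((⨆ c, summand K M n c : Submodule _ _) : Set (AddMonoidAlgebra K (Fin d → ℝ))) =
      rootRing K M n := by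
  have hS : ∀ m ∈ scaledMonoid M 1, ∀ x ∈ (scaledMonoid M n : Set (Fin d → ℝ)),
      m + x ∈ (scaledMonoid M n : Set (Fin d → ℝ)) := by
    rintro _ ⟨z, hz, rfl⟩ x hx
    exact (scaledMonoid M n).add_mem (scaledEmb_one_eq n z ▸ ⟨_, M.nsmul_mem hz _, rfl⟩) hx
  refine Set.Subset.antisymm ?_ fun f hf => ?_
  · have hle : ⨆ c, summand K M n c ≤ monomialModule K (scaledMonoid M 1) _ hS :=
      iSup_le fun c f hf x hx => (hf x hx).1
    exact fun f hf => hle hf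
  · have hf' : f = ∑ x ∈ f.coeff.support, single x (f.coeff x) := (sum_coeff_single f).symm
    rw [SetLike.mem_coe, hf']
    refine Submodule.sum_mem _ fun x hx => ?_
    have hxM : x ∈ scaledMonoid M n := hf x hx
    have hxL : x ∈ scaledLattice d n := by
      obtain ⟨z, -, rfl⟩ := hxM
      exact ⟨z, rfl⟩
    have hmem : single x (f.coeff x) ∈ summand K M n (QuotientAddGroup.mk ⟨x, hxL⟩) := by
      intro y hy
      rw [Finset.mem_singleton.1 (Finsupp.support_single_subset hy)]
      exact ⟨hxM, hxL, rfl⟩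
    exact Submodule.mem_iSup_of_mem _ hmem

end Decomposition

/-! ### Conic ideals and their multiplicities -/

section ConicIdeals

variable {K : Type*} [Field K] {d s : ℕ} {M : AddSubmonoid (Fin d → ℤ)} {σ : Fin s → Fin d → ℤ}

/-- The exponents of the monomials in the conic ideal `𝒞(y)`. -/
def conicSet (M : AddSubmonoid (Fin d → ℤ)) (y : Fin d → ℝ) : Set (Fin d → ℝ) :=
  {x | x ∈ scaledLattice d 1 ∧ x - y ∈ realCone M}

/-- Integral forms take integral values at `z`, so the real bound `σ i (y)` may be rounded up. Hence
only the ceilings matter. -/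
theorem IsSupportForms.scaledEmb_mem_conicSet (hσ : IsSupportForms M σ) {y : Fin d → ℝ}
    {z : Fin d → ℤ} :
    scaledEmb d 1 z ∈ conicSet M y ↔ ∀ i, ⌈form (σ i) y⌉ ≤ dotProduct (σ i) z := by
  have : scaledEmb d 1 z ∈ conicSet M y ↔ scaledEmb d 1 z - y ∈ realCone M :=
    ⟨fun h => h.2, fun h => ⟨⟨z, rfl⟩, h⟩⟩
  rw [this, hσ.mem_realCone]
  refine forall_congr' fun i => ?_
  rw [form_sub, form_scaledEmb_one, sub_nonneg, Int.ceil_le]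

theorem IsSupportForms.conicSet_eq (hσ : IsSupportForms M σ) {y y' : Fin d → ℝ}
    (h : ∀ i, ⌈form (σ i) y⌉ = ⌈form (σ i) y'⌉) : conicSet M y = conicSet M y' := by
  have key : ∀ x ∈ scaledLattice d 1, (x ∈ conicSet M y ↔ x ∈ conicSet M y') := by
    rintro _ ⟨z, rfl⟩
    rw [hσ.scaledEmb_mem_conicSet, hσ.scaledEmb_mem_conicSet]
    simp only [h]
  ext x
  exact ⟨fun hx => (key x hx.1).1 hx, fun hx => (key x hx.1).2 hx⟩

theorem IsSupportForms.conic_eq (hσ : IsSupportForms M σ) {y y' : Fin d → ℝ}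
    (h : ∀ i, ⌈form (σ i) y⌉ = ⌈form (σ i) y'⌉) : conic K M y = conic K M y' := by
  have hset := hσ.conicSet_eq h
  ext f
  exact forall₂_congr fun x _ => Set.ext_iff.1 hset x

/-- The bound `⌈σ i (y)⌉` is attained on the conic set of `y`, so the ceilings are invariants of the
set. -/
theorem IsSupportForms.ceil_le_of_conicSet_subset (hM : IsPositiveNormalAffine M)
    (hσ : IsSupportForms M σ) {y y' : Fin d → ℝ} (h : conicSet M y ⊆ conicSet M y') (i : Fin s) :
    ⌈form (σ i) y'⌉ ≤ ⌈form (σ i) y⌉ := by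
  obtain ⟨w, hw⟩ := hσ.exists_dotProduct_eq_one i
  obtain ⟨v, hv, hv'⟩ := hσ.exists_facet_point hM i
  set b : Fin s → ℤ := fun k => ⌈form (σ k) y⌉ - ⌈form (σ i) y⌉ * dotProduct (σ k) w with hb
  -- The multiple of `w` gives `σ i` the required value; adding a large multiple of the facet point
  -- `v` leaves it unchanged and satisfies all other inequalities.
  set z : Fin d → ℤ := ⌈form (σ i) y⌉ • w + (∑ k, |b k|) • v with hz
  have hzk : ∀ k, dotProduct (σ k) z =
      ⌈form (σ i) y⌉ * dotProduct (σ k) w + (∑ k, |b k|) * dotProduct (σ k) v := by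
    intro k
    rw [hz, dotProduct_add, dotProduct_smul, dotProduct_smul, smul_eq_mul, smul_eq_mul]
  have hzi : dotProduct (σ i) z = ⌈form (σ i) y⌉ := by
    rw [hzk, hw, hv]
    ring
  rw [← hzi]
  refine hσ.scaledEmb_mem_conicSet.1 (h (hσ.scaledEmb_mem_conicSet.2 fun k => ?_)) i
  by_cases hk : k = i
  · rw [hk, hzi]
  · have h₁ : |b k| ≤ ∑ k, |b k| := Finset.single_le_sum (f := fun k => |b k|)
      (fun _ _ => abs_nonneg _) (Finset.mem_univ k)
    have h₂ : (∑ k, |b k|) * 1 ≤ (∑ k, |b k|) * dotProduct (σ k) v := by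
      gcongr
      exact hv' k hk
    have h₃ := le_abs_self (b k)
    have h₄ : b k = ⌈form (σ k) y⌉ - ⌈form (σ i) y⌉ * dotProduct (σ k) w := rfl
    rw [hzk]
    linarith

theorem IsSupportForms.exists_forall_le (hM : IsPositiveNormalAffine M) (hσ : IsSupportForms M σ)
    (b : Fin s → ℤ) : ∃ m ∈ M, ∀ i, b i ≤ dotProduct (σ i) m := by
  obtain ⟨m, hmM, hm⟩ := hσ.exists_mem_forall_pos hM
  refine ⟨(∑ k, (b k).natAbs) • m, M.nsmul_mem hmM _, fun i => ?_⟩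
  have h₁ : (b i).natAbs ≤ ∑ k, (b k).natAbs := Finset.single_le_sum
    (f := fun k => (b k).natAbs) (fun _ _ => Nat.zero_le _) (Finset.mem_univ i)
  have h₂ : ((b i).natAbs : ℤ) * 1 ≤ ((∑ k, (b k).natAbs : ℕ) : ℤ) * dotProduct (σ i) m := by
    gcongr
    exact hm i
  rw [dotProduct_smul, nsmul_eq_mul]
  omega

/-- Any `z ∈ ℤ^d` is a difference `m - (m - z)` in `M` once `m` is deep enough in the cone. This is
the rank-one hypothesis of `nonempty_linearEquiv_iff`. -/
theorem IsSupportForms.exists_add_eq_add (hM : IsPositiveNormalAffine M)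
    (hσ : IsSupportForms M σ) {x y : Fin d → ℝ} {z : Fin d → ℤ} (h : y = x + scaledEmb d 1 z) :
    ∃ m ∈ scaledMonoid M 1, ∃ m' ∈ scaledMonoid M 1, m + x = m' + y := by
  obtain ⟨m, hmM, hm⟩ := hσ.exists_forall_le hM fun i => dotProduct (σ i) z
  refine ⟨_, ⟨m, hmM, rfl⟩, _, ⟨m - z, (hσ.mem_iff hM).2 fun i => ?_, rfl⟩, ?_⟩
  · rw [dotProduct_sub, sub_nonneg]
    exact hm i
  · rw [h, map_sub]
    abel

theorem IsSupportForms.conicSet_nonempty (hM : IsPositiveNormalAffine M)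
    (hσ : IsSupportForms M σ) (y : Fin d → ℝ) : (conicSet M y).Nonempty := by
  obtain ⟨m, -, hm⟩ := hσ.exists_forall_le hM fun i => ⌈form (σ i) y⌉
  exact ⟨_, hσ.scaledEmb_mem_conicSet.2 hm⟩

theorem exists_eq_add_of_mem_scaledLattice {x y : Fin d → ℝ} (hx : x ∈ scaledLattice d 1)
    (hy : y ∈ scaledLattice d 1) : ∃ z, y = x + scaledEmb d 1 z := by
  obtain ⟨a, rfl⟩ := hx
  obtain ⟨b, rfl⟩ := hy
  exact ⟨b - a, by rw [map_sub]; abel⟩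

theorem add_mem_conicSet_iff {y : Fin d → ℝ} {x : Fin d → ℝ} {z : Fin d → ℤ} :
    scaledEmb d 1 z + x ∈ conicSet M (y + scaledEmb d 1 z) ↔ x ∈ conicSet M y := by
  refine and_congr ((scaledLattice d 1).add_mem_cancel_left ⟨z, rfl⟩) ?_
  rw [show scaledEmb d 1 z + x - (y + scaledEmb d 1 z) = x - y by abel]

/-- The exponents of the monomials in `I_c` are obtained from those in a conic ideal by
translation. -/
theorem IsSupportForms.mem_summandSet_iff (hM : IsPositiveNormalAffine M)
    (hσ : IsSupportForms M σ) {n : ℕ+} {y : Fin d → ℝ} (hy : -y ∈ scaledLattice d n)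
    {x : Fin d → ℝ} :
    (x ∈ scaledMonoid M n ∧ ∃ h : x ∈ scaledLattice d n,
      (QuotientAddGroup.mk ⟨x, h⟩ : ResidueClass d n) = QuotientAddGroup.mk ⟨-y, hy⟩) ↔
      x + y ∈ conicSet M y := by
  constructor
  · rintro ⟨⟨m, hm, rfl⟩, h, hc⟩
    obtain ⟨z, hz⟩ := (residueClass_eq_iff h hy).1 hc
    refine ⟨⟨-z, ?_⟩, ?_⟩
    · rw [map_neg, neg_eq_iff_eq_neg.1 hz]
      abel
    · rw [add_sub_cancel_right]
      exact (hσ.scaledEmb_mem_realCone_iff hM).2 hm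
  · rintro ⟨⟨z, hz⟩, h₂⟩
    rw [add_sub_cancel_right] at h₂
    have hx : x = scaledEmb d 1 z + -y := by rw [hz]; abel
    have hxL : x ∈ scaledLattice d n := by
      rw [hx]
      exact (scaledLattice d n).add_mem (scaledEmb_one_mem_scaledLattice n z) hy
    refine ⟨?_, hxL, (residueClass_eq_iff hxL hy).2 ⟨-z, by rw [hx, map_neg]; abel⟩⟩
    obtain ⟨w, rfl⟩ := hxL
    exact ⟨w, (hσ.scaledEmb_mem_realCone_iff hM).1 h₂, rfl⟩

/-- `I_c` is isomorphic to the conic ideal of a half-open cell if and only if `-c` meets the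
cell. -/
theorem IsSupportForms.nonempty_summand_equiv_iff (hM : IsPositiveNormalAffine M)
    (hσ : IsSupportForms M σ) {n : ℕ+} {u : Fin s → ℤ} {y₀ : Fin d → ℝ}
    (hy₀ : y₀ ∈ halfOpenCell σ u) {y : Fin d → ℝ} (hy : -y ∈ scaledLattice d n) :
    Nonempty (summand K M n (QuotientAddGroup.mk ⟨-y, hy⟩) ≃ₗ[ring K M] conic K M y₀) ↔
      ∃ z : Fin d → ℤ, y + scaledEmb d 1 z ∈ halfOpenCell σ u := by
  obtain ⟨x₀, hx₀⟩ := hσ.conicSet_nonempty hM y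
  have hiff := nonempty_linearEquiv_iff (K := K) (N := scaledMonoid M 1)
    (S := {x | x ∈ scaledMonoid M n ∧ ∃ h : x ∈ scaledLattice d n,
      (QuotientAddGroup.mk ⟨x, h⟩ : ResidueClass d n) = QuotientAddGroup.mk ⟨-y, hy⟩})
    (T := conicSet M y₀) (hS := fun m hm x hx => by
      rw [Set.mem_ofPred_eq, hσ.mem_summandSet_iff hM] at hx ⊢
      obtain ⟨z, hz, rfl⟩ := hm
      rw [add_assoc]
      refine ⟨(scaledLattice d 1).add_mem ⟨z, rfl⟩ hx.1, ?_⟩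
      rw [add_sub_assoc]
      exact (realCone M).add_mem (scaledEmb_mem_realCone hz) hx.2)
    (hT := fun m hm x hx => by
      obtain ⟨z, hz, rfl⟩ := hm
      refine ⟨(scaledLattice d 1).add_mem ⟨z, rfl⟩ hx.1, ?_⟩
      rw [add_sub_assoc]
      exact (realCone M).add_mem (scaledEmb_mem_realCone hz) hx.2)
    (fun x hx x' hx' => by
      obtain ⟨-, h, hc⟩ := hx
      obtain ⟨-, h', hc'⟩ := hx'
      obtain ⟨z, hz⟩ := (residueClass_eq_iff h h').1 (hc.trans hc'.symm)
      exact hσ.exists_add_eq_add hM hz)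
    (fun x hx x' hx' => by
      obtain ⟨z, hz⟩ := exists_eq_add_of_mem_scaledLattice hx.1 hx'.1
      exact hσ.exists_add_eq_add hM hz)
    ⟨x₀ - y, (hσ.mem_summandSet_iff hM hy).2 (by rwa [sub_add_cancel])⟩
    (hσ.conicSet_nonempty hM y₀)
  refine hiff.trans ?_
  simp only [Set.mem_ofPred_eq, hσ.mem_summandSet_iff hM]
  rw [mem_halfOpenCell_iff_ceil] at hy₀
  constructor
  · rintro ⟨a, ha⟩
    have ha' : ∀ x, x ∈ conicSet M y ↔ a - y + x ∈ conicSet M y₀ := fun x => by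
      have := ha (x - y)
      rwa [sub_add_cancel, add_sub, add_sub_right_comm] at this
    obtain ⟨z, hz⟩ := exists_eq_add_of_mem_scaledLattice hx₀.1 ((ha' x₀).1 hx₀).1
    -- Both conic sets lie in `ℤ^d`, so a translation taking one to the other is integral; it can be
    -- absorbed by moving `y` within its class.
    have haz : a - y = scaledEmb d 1 z := by
      rw [add_comm] at hz
      exact add_left_cancel hz
    have hset : conicSet M y₀ = conicSet M (y + scaledEmb d 1 z) := by
      ext x
      have h₁ := ha' (x - scaledEmb d 1 z)
      rw [haz, add_sub_cancel] at h₁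
      rw [← h₁, ← add_mem_conicSet_iff (z := z), add_sub_cancel]
    refine ⟨z, mem_halfOpenCell_iff_ceil.2 fun i => ?_⟩
    rw [← hy₀ i]
    exact le_antisymm (hσ.ceil_le_of_conicSet_subset hM hset.le i)
      (hσ.ceil_le_of_conicSet_subset hM hset.ge i)
  · rintro ⟨z, hz⟩
    rw [mem_halfOpenCell_iff_ceil] at hz
    have hset : conicSet M y₀ = conicSet M (y + scaledEmb d 1 z) :=
      hσ.conicSet_eq fun i => (hy₀ i).trans (hz i).symm
    refine ⟨scaledEmb d 1 z + y, fun x => ?_⟩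
    rw [hset, add_assoc, add_mem_conicSet_iff, add_comm]

/-- The multiplicity of a conic class is the number of points of the half-open cell in the refined
lattice. -/
theorem IsSupportForms.multiplicity_eq (hM : IsPositiveNormalAffine M)
    (hσ : IsSupportForms M σ) (n : ℕ+) {u : Fin s → ℤ} {y₀ : Fin d → ℝ}
    (hy₀ : y₀ ∈ halfOpenCell σ u) :
    multiplicity K M n (conic K M y₀) = (halfOpenCell σ u ∩ scaledLattice d n).ncard := by
  rw [multiplicity, ← Nat.card_coe_set_eq]
  have hneg : ∀ {y : Fin d → ℝ}, y ∈ scaledLattice d n → -y ∈ scaledLattice d n :=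
    fun hy => (scaledLattice d n).neg_mem hy
  -- The bijection sends `y` to the class of `-y`; the sign comes from `I_{-y}` being a translate of
  -- `𝒞(y)`.
  refine (Nat.card_congr (Equiv.ofBijective
    (fun y : ↥(halfOpenCell σ u ∩ scaledLattice d n) =>
      (⟨QuotientAddGroup.mk ⟨-y.1, hneg y.2.2⟩,
        (hσ.nonempty_summand_equiv_iff hM hy₀ (hneg y.2.2)).2 ⟨0, by
          rw [map_zero, add_zero]
          exact y.2.1⟩⟩ :
        {c : ResidueClass d n // Nonempty (summand K M n c ≃ₗ[ring K M] conic K M y₀)}))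
    ⟨?_, ?_⟩)).symm
  · rintro ⟨y, hy, hyL⟩ ⟨y', hy', hyL'⟩ h
    obtain ⟨z, hz⟩ := (residueClass_eq_iff (hneg hyL) (hneg hyL')).1 (congrArg Subtype.val h)
    have hyz : y = y' + scaledEmb d 1 z := by
      rw [neg_eq_iff_eq_neg.1 hz]
      abel
    rw [mem_halfOpenCell_iff_ceil] at hy hy'
    -- Adding an integral `z` shifts each ceiling by `σ i (z)`; both points lie in the same
    -- half-open cell, so all these shifts vanish.
    have hz0 : z = 0 := hσ.eq_zero_of_forall_dotProduct hM fun i => by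
      have h₁ := hy i
      rw [hyz, form_add, form_scaledEmb_one, Int.ceil_add_intCast, hy' i] at h₁
      omega
    exact Subtype.ext (hyz.trans (by rw [hz0, map_zero, add_zero]))
  · rintro ⟨c, hc⟩
    obtain ⟨⟨x, hx⟩, rfl⟩ := QuotientAddGroup.mk_surjective c
    have hx' : -(-x) ∈ scaledLattice d n := by rwa [neg_neg]
    have hcx : (QuotientAddGroup.mk ⟨x, hx⟩ : ResidueClass d n) =
        QuotientAddGroup.mk ⟨-(-x), hx'⟩ := by
      rw [residueClass_eq_iff]
      exact ⟨0, by simp⟩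
    have hc' := hc
    rw [hcx, hσ.nonempty_summand_equiv_iff hM hy₀ hx'] at hc'
    obtain ⟨z, hz⟩ := hc'
    have hzL : -x + scaledEmb d 1 z ∈ scaledLattice d n :=
      (scaledLattice d n).add_mem (hneg hx) (scaledEmb_one_mem_scaledLattice n z)
    refine ⟨⟨_, hz, hzL⟩, Subtype.ext ?_⟩
    rw [residueClass_eq_iff]
    exact ⟨z, (by abel : x = -(-x + scaledEmb d 1 z) + scaledEmb d 1 z)⟩

theorem IsSupportForms.finite_halfOpenCell_inter (hM : IsPositiveNormalAffine M)
    (hσ : IsSupportForms M σ) (u : Fin s → ℤ) (n : ℕ+) :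
    (halfOpenCell σ u ∩ scaledLattice d n : Set (Fin d → ℝ)).Finite := by
  rw [halfOpenCell_inter_scaledLattice]
  exact (hσ.finite_latticePoints hM _).image _

end ConicIdeals

end ConicClasses

end

/-! ### The theorem -/

theorem mainTheorem1 (K : Type*) [Field K] {d s : ℕ} (M : AddSubmonoid (Fin d → ℤ))
    (hM : ConicClasses.IsPositiveNormalAffine M)
    (σ : Fin s → Fin d → ℤ) (hσ : ConicClasses.IsSupportForms M σ)
    (γ : Set (Fin d → ℝ)) (hγ : ConicClasses.IsOpenCell σ γ) :
    -- `R^{1/n}` is the direct sum of its `R`-submodules `I_c`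
    (∀ n : ℕ+, iSupIndep (ConicClasses.summand K M n) ∧
      ((⨆ c, ConicClasses.summand K M n c : Submodule _ _) : Set (AddMonoidAlgebra K (Fin d → ℝ))) =
        ConicClasses.rootRing K M n) ∧
    -- the ideals `𝒞(x)`, `x ∈ ⌈γ⌉`, all coincide with one ideal `𝒞_γ`
    ∃ C : Submodule (ConicClasses.ring K M) (AddMonoidAlgebra K (Fin d → ℝ)),
      (∀ x ∈ ConicClasses.cellCeil σ γ, ConicClasses.conic K M x = C) ∧
      -- the multiplicity is the number of points of `⌈γ⌉ ∩ (1/n) ℤ^d`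
      (∀ n : ℕ+, (ConicClasses.cellCeil σ γ ∩ ConicClasses.scaledLattice d n).encard =
        ConicClasses.multiplicity K M n C) ∧
      -- the multiplicity is a quasi-polynomial for all `n ≥ 1`
      ∃ q : ℤ → ℤ,
        ConicClasses.IsQuasiPolynomial (fun n => (q n : ℚ)) d ∧
        (∀ n : ℕ+, (ConicClasses.multiplicity K M n C : ℤ) = q (n : ℕ)) ∧
        ∃ (vol a : ℚ) (q' : ℤ → ℚ),
          MeasureTheory.volume γ = ENNReal.ofReal (vol : ℝ) ∧
          ConicClasses.IsQuasiPolynomial q' ((d : ℤ) - 2) ∧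
          ∀ n : ℤ, (q n : ℚ) = vol * (n : ℚ) ^ d + a * (n : ℚ) ^ ((d : ℤ) - 1) + q' n := by
  refine ⟨fun n => ⟨ConicClasses.iSupIndep_summand n, ConicClasses.coe_iSup_summand n⟩, ?_⟩
  obtain ⟨hne, u, hu⟩ := hγ
  have hceil := ConicClasses.cellCeil_eq_halfOpenCell hne hu
  obtain ⟨y₀, hy₀⟩ : ∃ y₀, y₀ ∈ ConicClasses.halfOpenCell σ u := by
    obtain ⟨y, hy⟩ := hne
    exact ⟨y, hceil ▸ ⟨y, hy, fun _ => rfl⟩⟩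
  obtain ⟨q, hq, hqn, vol, a, q', hvol, hq', hqq⟩ := hσ.exists_counting_quasiPolynomial hM u
  refine ⟨ConicClasses.conic K M y₀, fun x hx => ?_, fun n => ?_, q, hq, fun n => ?_, vol, a, q',
    ?_, hq', hqq⟩
  · rw [hceil, ConicClasses.mem_halfOpenCell_iff_ceil] at hx
    rw [ConicClasses.mem_halfOpenCell_iff_ceil] at hy₀
    exact hσ.conic_eq fun i => (hx i).trans (hy₀ i).symm
  · rw [hceil, hσ.multiplicity_eq hM n hy₀, (hσ.finite_halfOpenCell_inter hM u n).cast_ncard_eq]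
  · rw [hσ.multiplicity_eq hM n hy₀, hqn]
  · rw [ConicClasses.volume_openCell_eq hne hu, hvol]
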